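/- Let $\mathbb F\in\{\mathbb R,\mathbb C\}$ and let $M\in M_{n\times n}(\mathbb R)$ have a single eigenvalue $\lambda\in\mathbb F$: if $\mathbb F=\mathbb R$, then $\lambda$ is the only complex eigenvalue of $M$; if $\mathbb F=\mathbb C$, then $\lambda\notin\mathbb R$ and the eigenvalues of $M$ are exactly $\lambda$ and $\bar\lambda$. Let $l$ be the multiplicity of $\lambda$ as a root of the minimal polynomial of $M$, so that the real algebra $A$ generated by $M^{\intercal}$ is isomorphic to $\mathbb F[x]/((x-\lambda)^l)$, with $M^{\intercal}$ corresponding to $x$. Put $e=x-\lambda\in A$, $\mathfrak m=(e)$. Let $\mu_{\mathbb R}=\mathrm{id}$, $\mu_{\mathbb C}=\operatorname{Im}$, and $\phi_{\mathbb F}\colon A\to\mathbb R$, $\phi_{\mathbb F}\bigl(\sum_{i=0}^{l-1}a_ie^i\bigr)=\mu_{\mathbb F}(a_{l-1})$. Fix a decomposition of the $A$-module $B=\mathbb R^n$ (on which $M^{\intercal}$ acts as $x$) into a direct sum of cyclic modules $\mathbb F[x]/((x-\lambda)^{s})$, $s\ge1$, that is, a Jordan normal form of $M^{\intercal}$. It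 makes $B$ a vector space over $\mathbb F$, and $\lambda I$ denotes the action of $\lambda\in\mathbb F$ on $B$. Denote by $e_1,\dots,e_r$ the units of the summands and by $s_1,\dots,s_r$ the exponents. For $k=0,\dots,l-1$ let $D_k$ be the sum of the summands with $s_i\ge l-k$ and $C_k$ the sum of the others, so that $B=C_k\oplus D_k$. Let $\pi_{D_k}\colon B\to D_k/\mathfrak mD_k$ be the projection onto $D_k$ along $C_k$ followed by the quotient map, and let $\rho_{D_k}\colon D_k/\mathfrak mD_k\to B$ be the $\mathbb F$-linear map with $\rho_{D_k}([e_i])=e_i$. For a symmetric $\mathbb F$-multilinear $g\colon B^j\to\mathbb F$ that vanishes when one of its arguments lies in $C_k$ or in $\mathfrak mB$, let $G^j_{(e^k)}g\colon B^j\to (e^k)\subset A$ be the $A$-multilinear map with $G^j_{(e^k)}g(e_{i_1},\dots,e_{i_j})=g(e_{i_1},\dots,e_{i_j})\,e^k$. For an open set $V$, $C^m_{\mathbb F}(\overline V,\mathbb F)$ denotes the set of continuous functions on $\overline V$ that are of class $C^m$ in $V$ (for $\mathbb F=\mathbb C$: complex differentiable) and whose derivatives of order at most $m$ extend continuously to $\overline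 V$; $C^m(\overline V)$ is the analogous set of real-valued, $C^m$ functions. Derivatives at boundary points are understood as these extensions. Theorem. Let $U\subset\mathbb R^n$ be convex, open and bounded, with $\overline{\rho_{D_i}\pi_{D_i}(U)}\subset\overline U$ for $i=0,\dots,l-1$, and let $t\ge2$ be an integer. Then for any functions $f_i\in C^{t+l-1-i}_{\mathbb F}(\overline{\pi_{D_i}(U)},\mathbb F)$, $i=0,\dots,l-1$, there exists a unique $v\in C^t(\overline U)$ such that \[ \begin{aligned} &D^2v(b)(M^{\intercal}x,y)=D^2v(b)(x,M^{\intercal}y)\quad\text{for all } b\in U,\ x,y\in\mathbb R^n,\\ &v=\mu_{\mathbb F}\circ f_{l-1}\circ\pi_{D_{l-1}}\quad\text{on }\overline{\rho_{D_{l-1}}\pi_{D_{l-1}}(U)},\\ &Dv(b)\bigl((M^{\intercal}-\lambda I)^{l-1-i}x\bigr)=\mu_{\mathbb F}\bigl(D(f_i\circ\pi_{D_i})(b)(x)\bigr)\quad\text{for all } b\in\overline{\rho_{D_i}\pi_{D_i}(U)},\ x\in\rho_{D_i}\pi_{D_i}(B),\ i=0,\dots,l-2. \end{aligned} \] The unique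 solution is $v=\phi_{\mathbb F}(Tf)$, where \[ Tf(u)=\sum_{k=0}^{l-1}\Bigl(f_k(\pi_{D_k}(u))\,e^k+\sum_{j=1}^{l-1-k}\frac1{j!}\,G^j_{(e^k)}\bigl(D^jf_k(\pi_{D_k}(u))\circ\pi_{D_k}\bigr)\bigl(u-\rho_{D_k}\pi_{D_k}(u),\dots,u-\rho_{D_k}\pi_{D_k}(u)\bigr)\Bigr). \] -/

import Mathlib

open Polynomial

noncomputable section

namespace GenLaplace

/-- `μ_𝔽 : 𝔽 → ℝ`: the identity when `𝔽 = ℝ` and the imaginary part when `𝔽 = ℂ`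
(`RCLike.I = 0` singles out the real case). -/
def mu {𝕜 : Type*} [RCLike 𝕜] (z : 𝕜) : ℝ :=
  open Classical in if (RCLike.I : 𝕜) = 0 then RCLike.re z else RCLike.im z

/-- The real matrix `M` has the single eigenvalue `lam ∈ 𝔽`: if `𝔽 = ℝ`, then `lam` is the only
complex eigenvalue of `M`; if `𝔽 = ℂ`, then `lam` is not real and the complex eigenvalues of `M`
are exactly `lam` and its conjugate (which always accompanies it, as `M` is real). -/
def HasSingleEigenvalue {𝕜 : Type*} [RCLike 𝕜] {n : ℕ} (M : Matrix (Fin n) (Fin n) ℝ)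
    (lam : 𝕜) : Prop :=
  ((RCLike.I : 𝕜) ≠ 0 → RCLike.im lam ≠ 0) ∧
    ∀ z : ℂ, Module.End.HasEigenvalue (Matrix.toLin' (M.map (algebraMap ℝ ℂ))) z ↔
      z = ⟨RCLike.re lam, RCLike.im lam⟩ ∨ z = ⟨RCLike.re lam, -RCLike.im lam⟩

/-- The exponent `l` of `X - lam` in the minimal polynomial of `M`, factored over `𝔽`. -/
def eigenIndex {𝕜 : Type*} [RCLike 𝕜] {n : ℕ} (M : Matrix (Fin n) (Fin n) ℝ) (lam : 𝕜) : ℕ :=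
  ((minpoly ℝ M).map (algebraMap ℝ 𝕜)).rootMultiplicity lam

/-- The local algebra `𝔽[X] / ((X - lam) ^ s)`. -/
abbrev LocAlg {𝕜 : Type*} [RCLike 𝕜] (lam : 𝕜) (s : ℕ) : Type _ :=
  AdjoinRoot ((X - C lam) ^ s : 𝕜[X])

/-- The representative of degree `< s` of an element of `𝔽[X] / ((X - lam) ^ s)`. -/
def LocAlg.rep {𝕜 : Type*} [RCLike 𝕜] (lam : 𝕜) (s : ℕ) : LocAlg lam s →ₗ[𝕜] 𝕜[X] :=
  AdjoinRoot.modByMonicHom ((monic_X_sub_C lam).pow s)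

/-- The element `e = [X - lam]`, which generates the maximal ideal. -/
def LocAlg.e {𝕜 : Type*} [RCLike 𝕜] (lam : 𝕜) (s : ℕ) : LocAlg lam s :=
  AdjoinRoot.mk _ (X - C lam)

/-- The coefficient `a_q` of `∑_{i < s} a_i e ^ i ∈ 𝔽[X] / ((X - lam) ^ s)`. -/
def LocAlg.coeff {𝕜 : Type*} [RCLike 𝕜] {lam : 𝕜} {s : ℕ} (q : ℕ) (a : LocAlg lam s) : 𝕜 :=
  (taylor lam (LocAlg.rep lam s a)).coeff q

/-- The functional `φ_𝔽 (∑_{i < l} a_i e ^ i) = μ_𝔽 a_{l-1}` on `A = 𝔽[X] / ((X - lam) ^ l)`. -/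
def phi {𝕜 : Type*} [RCLike 𝕜] {lam : 𝕜} {l : ℕ} (a : LocAlg lam l) : ℝ :=
  mu (LocAlg.coeff (l - 1) a)

/-- `f ∈ C^k_𝔽(closure V, F)` for an open set `V`: `f` is continuous on `closure V`, it is of class
`C^k` over `𝔽` on `V` (for `𝔽 = ℂ` and `1 ≤ k`, this includes complex differentiability), and its
derivatives of order at most `k` extend continuously to `closure V`.
Only the values of `f` on `closure V` matter. -/
structure CkClosure (𝕜 : Type*) [RCLike 𝕜] {E F : Type*} [NormedAddCommGroup E] [NormedSpace 𝕜 E]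
    [NormedAddCommGroup F] [NormedSpace 𝕜 F] (k : ℕ) (V : Set E) (f : E → F) : Prop where
  continuousOn : ContinuousOn f (closure V)
  contDiffOn : ContDiffOn 𝕜 k f V
  extends_iteratedFDeriv : ∀ m : ℕ, m ≤ k →
    ∃ g : E → ContinuousMultilinearMap 𝕜 (fun _ : Fin m => E) F,
      ContinuousOn g (closure V) ∧ Set.EqOn g (iteratedFDeriv 𝕜 m f) V

/-- A decomposition of `B = ℝ ^ n`, as a module over the algebra generated by `Mᵀ`, into a direct
sum of cyclic modules `𝔽[X] / ((X - lam) ^ t)`, `t ≥ 1`, on which `Mᵀ` acts as multiplication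
by `X`. In other words: a Jordan normal form of `Mᵀ`. -/
structure CyclicDecomposition {𝕜 : Type*} [RCLike 𝕜] {n : ℕ} (M : Matrix (Fin n) (Fin n) ℝ)
    (lam : 𝕜) where
  /-- the number of summands -/
  count : ℕ
  /-- the exponent `t` of each summand -/
  size : Fin count → ℕ
  size_pos : ∀ i, 1 ≤ size i
  /-- the isomorphism of `ℝ ^ n` with the direct sum -/
  equiv : (Fin n → ℝ) ≃ₗ[ℝ] (∀ i, LocAlg lam (size i))
  equiv_mulVec : ∀ (x : Fin n → ℝ) (i : Fin count),
    equiv (M.transpose.mulVec x) i = AdjoinRoot.root _ * equiv x i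

namespace CyclicDecomposition

variable {𝕜 : Type*} [RCLike 𝕜] {n : ℕ} {M : Matrix (Fin n) (Fin n) ℝ} {lam : 𝕜}
  (D : CyclicDecomposition M lam)

/-- The unit `e_i` of the `i`-th summand, as an element of `B`. -/
def gen (i : Fin D.count) : Fin n → ℝ :=
  D.equiv.symm (Pi.single i 1)

/-- The operator `Mᵀ - lam I` on `B`, where `lam` acts through the `𝔽`-linear structure that `B`
carries as a direct sum of `𝔽`-algebras. It is the action of `e` on `B`. -/
def nil : (Fin n → ℝ) →ₗ[ℝ] (Fin n → ℝ) where
  toFun x := M.transpose.mulVec x - D.equiv.symm (lam • D.equiv x)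
  map_add' x y := by
    simp only [Matrix.mulVec_add, map_add, smul_add]
    abel
  map_smul' c x := by
    simp only [Matrix.mulVec_smul, map_smul, smul_comm lam c, smul_sub, RingHom.id_apply]

/-- The summands that make up `D_k`: those with exponent `t ≥ l - k`. -/
abbrev Idx (l k : ℕ) : Type :=
  {i : Fin D.count // l ≤ D.size i + k}

/-- The map `π_{D_k} : B → D_k / 𝔪 D_k`: the projection onto `D_k` along the other summands,
followed by the quotient map; `D_k / 𝔪 D_k` is written in its `𝔽`-basis `[e_i]`. -/
def proj (l k : ℕ) (u : Fin n → ℝ) : D.Idx l k → 𝕜 :=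
  fun i => LocAlg.coeff 0 (D.equiv u i.1)

/-- The section `ρ_{D_k} : D_k / 𝔪 D_k → B`, `ρ_{D_k} (∑ z_i [e_i]) = ∑ z_i e_i`. -/
def sect (l k : ℕ) (z : D.Idx l k → 𝕜) : Fin n → ℝ :=
  D.equiv.symm (fun i => if h : l ≤ D.size i + k then algebraMap 𝕜 _ (z ⟨i, h⟩) else 0)

/-- The composition `ρ_{D_k} π_{D_k} : B → B`. -/
def retr (l k : ℕ) (u : Fin n → ℝ) : Fin n → ℝ :=
  D.sect l k (D.proj l k u)

/-- The lifting `G^j_{(e ^ k)} g : B ^ j → (e ^ k) ⊆ A` of a multilinear function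
`g : B ^ j → (e ^ k) / 𝔪 (e ^ k) = 𝔽 [e ^ k]` that vanishes if one argument is in a summand outside
`D_k`: it takes the value `g (e_{i_1}, …, e_{i_j}) e ^ k` at `(e_{i_1}, …, e_{i_j})` and is extended
`A`-multilinearly. -/
def lift (l k j : ℕ) (g : (Fin j → (Fin n → ℝ)) → 𝕜) (w : Fin j → (Fin n → ℝ)) : LocAlg lam l :=
  ∑ i : Fin j → Fin D.count,
    (∏ r, AdjoinRoot.mk _ (LocAlg.rep lam (D.size (i r)) (D.equiv (w r) (i r)))) *
      (algebraMap 𝕜 (LocAlg lam l) (g fun r => D.gen (i r)) * LocAlg.e lam l ^ k)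

/-- The `j`-th derivative over `𝔽` of a function on `π_{D_k}(U)`, extended continuously to the
closure of `π_{D_k}(U)`. -/
def dataDeriv (l k j : ℕ) (U : Set (Fin n → ℝ)) (g : (D.Idx l k → 𝕜) → 𝕜)
    (p : D.Idx l k → 𝕜) : ContinuousMultilinearMap 𝕜 (fun _ : Fin j => D.Idx l k → 𝕜) 𝕜 :=
  extendFrom (D.proj l k '' U) (iteratedFDeriv 𝕜 j g) p

/-- The operator `T`:
`Tf (u) = ∑_{k < l} (f_k (π u) e ^ k + ∑_{j = 1}^{l - 1 - k} 1 / j! G^j D^j f_k (π u) ((u - ρ π u)^j))`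
with `π = π_{D_k}`, `ρ = ρ_{D_k}`. -/
def T (l : ℕ) (U : Set (Fin n → ℝ)) (f : ∀ k : ℕ, (D.Idx l k → 𝕜) → 𝕜) (u : Fin n → ℝ) :
    LocAlg lam l :=
  ∑ k ∈ Finset.range l,
    (algebraMap 𝕜 (LocAlg lam l) (f k (D.proj l k u)) * LocAlg.e lam l ^ k +
      ∑ j ∈ Finset.Icc 1 (l - 1 - k),
        ((j.factorial : 𝕜)⁻¹) •
          D.lift l k j
            (fun b => D.dataDeriv l k j U (f k) (D.proj l k u) (fun r => D.proj l k (b r)))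
            (fun _ => u - D.retr l k u))

/-- `v ∈ C^t(closure U)` solves the boundary value problem with data `f_0, …, f_{l-1}`.
Derivatives at points of `closure U` are the continuous extensions of the derivatives in `U`. -/
structure IsSolution (l t : ℕ) (U : Set (Fin n → ℝ)) (f : ∀ k : ℕ, (D.Idx l k → 𝕜) → 𝕜)
    (v : (Fin n → ℝ) → ℝ) : Prop where
  regular : CkClosure ℝ t U v
  /-- the generalized Laplace equations `D²v(b)(Mᵀ x, y) = D²v(b)(x, Mᵀ y)` -/
  laplace : ∀ b ∈ U, ∀ x y : Fin n → ℝ,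
    iteratedFDeriv ℝ 2 v b ![M.transpose.mulVec x, y] =
      iteratedFDeriv ℝ 2 v b ![x, M.transpose.mulVec y]
  /-- the values of `v` on the last slice -/
  boundary_value : ∀ b ∈ closure (D.retr l (l - 1) '' U),
    v b = mu (f (l - 1) (D.proj l (l - 1) b))
  /-- the derivatives `Dv(b)((Mᵀ - lam I) ^ (l - 1 - i) x)` on the other slices -/
  boundary_deriv : ∀ i : ℕ, i + 1 < l → ∀ b ∈ closure (D.retr l i '' U),
    ∀ x ∈ Set.range (D.retr l i),
      extendFrom U (fderiv ℝ v) b ((D.nil ^ (l - 1 - i)) x) =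
        mu (extendFrom U (fderiv ℝ fun u => f i (D.proj l i u)) b x)

end CyclicDecomposition

end GenLaplace

end

/-! Existence. Lift the components of u to elements u_c of A, and split each u_c with c in D_k into
a constant coordinate and an increment divisible by e. Since e^k e^(l-k) = 0, the k-th part of `T`
is e^k times the whole formal Taylor series of f_k at the A-valued point (u_c): the truncation loses
nothing. Hence it behaves like an A-differentiable function. Its derivative in direction x is the
sum over c of the same expression for ∂_c f_k, multiplied by x_c (`hasFDerivAt_taylorSum`,
`hasFDerivAt_term`). So only l-1-k orders of smoothness of f_k are lost, and D²v(x, y) is φ of a sum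
of products with x_d y_c, in which multiplication by the root moves freely from x to y
(`laplace_phi_T`). On the slices all increments vanish and the k-th part is f_k e^k. As φ reads the
coefficient of e^(l-1), values see only k = l-1, and derivatives along the image of N^(l-1-i), where
N = `nil`, see only k = i.

Uniqueness. N is a real polynomial in the transpose of M (`exists_aeval_eq_nil`), so it too is
self-adjoint for D²w, where w is the difference of two solutions. By induction on i, Dw kills the
image of N^(l-i). Indeed N^(l-1-i)(u - ρπu) lies in the image of N^(l-i) (`exists_nil_pow_eq`), so
Dw(N^(l-1-i) x) is constant on the segment from u to ρπu, where the boundary condition makes it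
zero. One last such segment carries w itself to the last slice (`eq_zero_of_homogeneous`). -/

noncomputable section

namespace GenLaplace

/-! ### The local algebras 𝔽[X]/((X - λ)^s) and their coefficients -/

section LocAlg

variable {𝕜 : Type*} [RCLike 𝕜] {lam : 𝕜}

/-- `LocAlg.coeff q` as a linear map. -/
def LocAlg.coeffₗ (lam : 𝕜) (s q : ℕ) : LocAlg lam s →ₗ[𝕜] 𝕜 :=
  (lcoeff 𝕜 q).comp ((taylor lam).comp (LocAlg.rep lam s))

@[simp] lemma LocAlg.coeffₗ_apply (s q : ℕ) (a : LocAlg lam s) :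
    LocAlg.coeffₗ lam s q a = LocAlg.coeff q a := rfl

lemma LocAlg.rep_mk (s : ℕ) (p : 𝕜[X]) :
    LocAlg.rep lam s (AdjoinRoot.mk _ p) = p %ₘ (X - C lam) ^ s :=
  AdjoinRoot.modByMonicHom_mk _ p

lemma taylor_X_sub_C (lam : 𝕜) : taylor lam (X - C lam) = X := by simp

/-- The Taylor shift turns X - λ into X, so reduction modulo the s-th power only affects
coefficients from s onwards. -/
lemma LocAlg.coeff_mk {s q : ℕ} (h : q < s) (p : 𝕜[X]) :
    LocAlg.coeff q (AdjoinRoot.mk ((X - C lam) ^ s) p) = (taylor lam p).coeff q := by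
  have key : taylor lam p = taylor lam (p %ₘ (X - C lam) ^ s) +
      X ^ s * taylor lam (p /ₘ (X - C lam) ^ s) := by
    conv_lhs => rw [← modByMonic_add_div p ((X - C lam) ^ s)]
    rw [map_add, taylor_mul, taylor_pow, taylor_X_sub_C]
  rw [LocAlg.coeff, LocAlg.rep_mk, key, coeff_add, coeff_X_pow_mul', if_neg (by omega), add_zero]

lemma LocAlg.e_pow_self (s : ℕ) : LocAlg.e lam s ^ s = 0 := by
  rw [LocAlg.e, ← map_pow, AdjoinRoot.mk_self]

lemma LocAlg.coeff_algebraMap_mul_e_pow {s q : ℕ} (h : q < s) (c : 𝕜) (k : ℕ) :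
    LocAlg.coeff q (algebraMap 𝕜 (LocAlg lam s) c * LocAlg.e lam s ^ k) =
      if q = k then c else 0 := by
  rw [LocAlg.e, AdjoinRoot.algebraMap_eq, AdjoinRoot.of, RingHom.comp_apply, ← map_pow, ← map_mul,
    LocAlg.coeff_mk h, taylor_mul, taylor_pow, taylor_X_sub_C, taylor_C, coeff_C_mul, coeff_X_pow]
  simp

lemma LocAlg.exists_eq_e_mul {s : ℕ} (hs : 1 ≤ s) (a : LocAlg lam s) (h : LocAlg.coeff 0 a = 0) :
    ∃ b, a = LocAlg.e lam s * b := by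
  obtain ⟨p, rfl⟩ := AdjoinRoot.mk_surjective a
  rw [LocAlg.coeff_mk (by omega), taylor_coeff_zero] at h
  obtain ⟨q, rfl⟩ := dvd_iff_isRoot.mpr h
  exact ⟨AdjoinRoot.mk _ q, by rw [map_mul, LocAlg.e]⟩

lemma LocAlg.root_eq (s : ℕ) :
    AdjoinRoot.root ((X - C lam) ^ s : 𝕜[X]) = algebraMap 𝕜 _ lam + LocAlg.e lam s := by
  rw [LocAlg.e, map_sub, AdjoinRoot.mk_X, AdjoinRoot.mk_C, AdjoinRoot.algebraMap_eq]; ring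

/-- The `𝕜`-linear map `𝕜[X] / (X - lam) ^ s → 𝕜[X] / (X - lam) ^ l` that sends a class to the
class of its representative of degree `< s`. -/
def LocAlg.hat (lam : 𝕜) (s l : ℕ) : LocAlg lam s →ₗ[𝕜] LocAlg lam l :=
  (AdjoinRoot.mkₐ ((X - C lam) ^ l) : 𝕜[X] →ₐ[𝕜] LocAlg lam l).toLinearMap.comp (LocAlg.rep lam s)

lemma LocAlg.hat_apply (s l : ℕ) (a : LocAlg lam s) :
    LocAlg.hat lam s l a = AdjoinRoot.mk _ (LocAlg.rep lam s a) := rfl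

/-- `hat` depends on representatives and is not multiplicative. The error is a multiple of e^s,
which e^k kills; this is why f_k involves only the summands of D_k. -/
lemma LocAlg.hat_mk_mul {s l k : ℕ} (h : l ≤ s + k) (p : 𝕜[X]) :
    LocAlg.hat lam s l (AdjoinRoot.mk _ p) * LocAlg.e lam l ^ k =
      AdjoinRoot.mk _ p * LocAlg.e lam l ^ k := by
  rw [LocAlg.hat_apply, LocAlg.rep_mk]
  have hp := congrArg (AdjoinRoot.mk ((X - C lam) ^ l)) (modByMonic_add_div p ((X - C lam) ^ s))
  have h0 : LocAlg.e lam l ^ s * LocAlg.e lam l ^ k = 0 := by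
    rw [← pow_add]; exact pow_eq_zero_of_le h (LocAlg.e_pow_self l)
  rw [map_add, map_mul, map_pow, ← LocAlg.e] at hp
  rw [← hp]
  linear_combination (-AdjoinRoot.mk ((X - C lam) ^ l) (p /ₘ (X - C lam) ^ s)) * h0

lemma LocAlg.hat_mk_mul_mul {s l k : ℕ} (h : l ≤ s + k) (q : 𝕜[X]) (a : LocAlg lam s) :
    LocAlg.hat lam s l (AdjoinRoot.mk _ q * a) * LocAlg.e lam l ^ k =
      AdjoinRoot.mk _ q * LocAlg.hat lam s l a * LocAlg.e lam l ^ k := by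
  obtain ⟨p, rfl⟩ := AdjoinRoot.mk_surjective a
  rw [← map_mul, LocAlg.hat_mk_mul h, map_mul, mul_assoc, mul_assoc, LocAlg.hat_mk_mul h]

lemma LocAlg.rep_algebraMap {s : ℕ} (hs : 1 ≤ s) (c : 𝕜) :
    LocAlg.rep lam s (algebraMap 𝕜 _ c) = C c := by
  rw [AdjoinRoot.algebraMap_eq, AdjoinRoot.of, RingHom.comp_apply, LocAlg.rep_mk,
    modByMonic_eq_self_iff ((monic_X_sub_C lam).pow s)]
  refine degree_C_le.trans_lt ?_
  rw [degree_pow, degree_X_sub_C]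
  simpa using Nat.pos_of_ne_zero (by omega)

lemma LocAlg.hat_algebraMap {s : ℕ} (hs : 1 ≤ s) (l : ℕ) (c : 𝕜) :
    LocAlg.hat lam s l (algebraMap 𝕜 _ c) = algebraMap 𝕜 _ c := by
  rw [LocAlg.hat_apply, LocAlg.rep_algebraMap hs]; rfl

lemma LocAlg.coeff_zero_algebraMap {s : ℕ} (hs : 1 ≤ s) (c : 𝕜) :
    LocAlg.coeff 0 (algebraMap 𝕜 (LocAlg lam s) c) = c := by
  rw [LocAlg.coeff, LocAlg.rep_algebraMap hs, taylor_C, coeff_C_zero]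

lemma LocAlg.hat_eq_e_mul {s : ℕ} (l : ℕ) (a : LocAlg lam s)
    (h : LocAlg.coeff 0 a = 0) : ∃ b, LocAlg.hat lam s l a = LocAlg.e lam l * b := by
  have h1 : (X - C lam) ∣ LocAlg.rep lam s a := by
    rw [dvd_iff_isRoot, IsRoot, ← taylor_coeff_zero]; exact h
  obtain ⟨q, hq⟩ := h1
  exact ⟨AdjoinRoot.mk _ q, by rw [LocAlg.hat_apply, hq, map_mul, LocAlg.e]⟩

/-- `mu` as a real linear map. -/
def muₗ (𝕜 : Type*) [RCLike 𝕜] : 𝕜 →ₗ[ℝ] ℝ :=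
  open Classical in if (RCLike.I : 𝕜) = 0 then RCLike.reLm else RCLike.imLm

lemma muₗ_apply (z : 𝕜) : muₗ 𝕜 z = mu z := by
  unfold muₗ mu; split_ifs <;> simp

/-- `phi` as a real linear map. -/
def phiₗ (lam : 𝕜) (l : ℕ) : LocAlg lam l →ₗ[ℝ] ℝ :=
  (muₗ 𝕜).comp ((LocAlg.coeffₗ lam l (l - 1)).restrictScalars ℝ)

lemma phiₗ_apply {l : ℕ} (a : LocAlg lam l) : phiₗ lam l a = phi a := by
  simp [phiₗ, phi, muₗ_apply]

end LocAlg

/-! ### Realizing X - λ by a real polynomial -/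

section RealPolynomial

variable {𝕜 : Type*} [RCLike 𝕜]

/-- The equation for D²v is invariant only under real polynomials in the transpose of M, whereas
`nil` involves the action of a possibly complex λ; this lemma bridges the two. -/
lemma exists_real_polynomial (lam : 𝕜) (h : (RCLike.I : 𝕜) ≠ 0 → RCLike.im lam ≠ 0) (l : ℕ) :
    ∃ r : ℝ[X], (X - C lam) ^ l ∣ r.map (algebraMap ℝ 𝕜) - (X - C lam) := by
  by_cases hI : (RCLike.I : 𝕜) = 0
  · refine ⟨X - C (RCLike.re lam), ?_⟩
    have : algebraMap ℝ 𝕜 (RCLike.re lam) = lam := by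
      have := RCLike.re_add_im lam
      rw [hI, mul_zero, add_zero] at this
      simpa using this
    simp [this]
  · have hne : lam ≠ starRingEnd 𝕜 lam := fun hc =>
      h hI (RCLike.conj_eq_iff_im.mp hc.symm)
    have hcop : IsCoprime ((X - C lam) ^ l) ((X - C (starRingEnd 𝕜 lam)) ^ l) :=
      (isCoprime_X_sub_C_of_isUnit_sub (sub_ne_zero.mpr hne).isUnit).pow
    obtain ⟨a, b, hab⟩ := hcop
    -- Chinese remainders: g is X - λ modulo (X - λ)^l and 0 modulo the conjugate power. The
    -- conjugate of g is then 0 modulo (X - λ)^l, and the sum of the two is real.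
    set g : 𝕜[X] := b * (X - C (starRingEnd 𝕜 lam)) ^ l * (X - C lam) with hg
    have hgbar : (X - C lam) ^ l ∣ g.map (starRingEnd 𝕜) := by
      refine ⟨b.map (starRingEnd 𝕜) * (X - C (starRingEnd 𝕜 lam)), ?_⟩
      simp only [hg, Polynomial.map_mul, Polynomial.map_pow, Polynomial.map_sub, map_X, map_C,
        RingHomCompTriple.comp_apply, RingHom.id_apply]
      ring
    have hgl : (X - C lam) ^ l ∣ g - (X - C lam) :=
      ⟨-a * (X - C lam), by rw [hg]; linear_combination (X - C lam) * hab⟩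
    have hlift : g + g.map (starRingEnd 𝕜) ∈ lifts (algebraMap ℝ 𝕜) := by
      rw [lifts_iff_coeff_lifts]
      intro n
      refine ⟨2 * RCLike.re (g.coeff n), ?_⟩
      rw [coeff_add, coeff_map, RCLike.add_conj]
      rw [map_mul, map_ofNat, RCLike.algebraMap_eq_ofReal]
    obtain ⟨r, hr⟩ := hlift
    refine ⟨r, ?_⟩
    have hr' : r.map (algebraMap ℝ 𝕜) = g + g.map (starRingEnd 𝕜) := hr
    rw [hr', add_sub_right_comm]
    exact dvd_add hgl hgbar

end RealPolynomial

/-! ### The action of e on ℝⁿ -/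

namespace CyclicDecomposition

variable {𝕜 : Type*} [RCLike 𝕜] {n : ℕ} {M : Matrix (Fin n) (Fin n) ℝ} {lam : 𝕜}
  (D : CyclicDecomposition M lam)

lemma equiv_aeval (r : ℝ[X]) (x : Fin n → ℝ) (i : Fin D.count) :
    D.equiv (aeval (Matrix.toLin' M.transpose) r x) i =
      AdjoinRoot.mk _ (r.map (algebraMap ℝ 𝕜)) * D.equiv x i := by
  induction r using Polynomial.induction_on generalizing x with
  | C a =>
    have : AdjoinRoot.mk ((X - C lam) ^ D.size i : 𝕜[X]) (C (algebraMap ℝ 𝕜 a)) =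
      algebraMap ℝ (LocAlg lam (D.size i)) a := by
      rw [AdjoinRoot.mk_C, ← AdjoinRoot.algebraMap_eq, ← IsScalarTower.algebraMap_apply]
    rw [map_C, this, aeval_C, Module.algebraMap_end_apply, map_smul, Pi.smul_apply,
      Algebra.smul_def]
  | add p q hp hq => simp [hp, hq, add_mul]
  | monomial m a h =>
    rw [pow_succ, ← mul_assoc, map_mul, Module.End.mul_apply, h, aeval_X, Matrix.toLin'_apply,
      D.equiv_mulVec, Polynomial.map_mul _ (p := C a * X ^ m), Polynomial.map_X, map_mul _ _ X,
      AdjoinRoot.mk_X, mul_assoc]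

lemma equiv_nil (x : Fin n → ℝ) (i : Fin D.count) :
    D.equiv (D.nil x) i = LocAlg.e lam _ * D.equiv x i := by
  change D.equiv (M.transpose.mulVec x - D.equiv.symm (lam • D.equiv x)) i = _
  rw [map_sub, Pi.sub_apply, D.equiv_mulVec, LinearEquiv.apply_symm_apply, Pi.smul_apply,
    LocAlg.root_eq, Algebra.smul_def]
  ring

lemma equiv_nil_pow (m : ℕ) (x : Fin n → ℝ) (i : Fin D.count) :
    D.equiv ((D.nil ^ m) x) i = LocAlg.e lam _ ^ m * D.equiv x i := by
  induction m with
  | zero => simp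
  | succ m ih => rw [pow_succ', Module.End.mul_apply, equiv_nil, ih]; ring

/-- The minimal polynomial of M also annihilates its transpose. Applied to the unit of a summand, it
gives its own class there, which must be zero. -/
lemma size_le_eigenIndex (i : Fin D.count) : D.size i ≤ eigenIndex M lam := by
  have hmon : ((minpoly ℝ M).map (algebraMap ℝ 𝕜)).Monic :=
    (minpoly.monic (Algebra.IsIntegral.isIntegral M)).map _
  rw [eigenIndex, le_rootMultiplicity_iff hmon.ne_zero, ← AdjoinRoot.mk_eq_zero]
  have h0 : aeval (Matrix.toLin' M.transpose) (minpoly ℝ M) = 0 := by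
    have h1 : aeval M.transpose (minpoly ℝ M) = 0 := by
      have := congrArg Matrix.transpose (minpoly.aeval ℝ M)
      rw [Matrix.transpose_zero] at this
      rw [← this]
      simp only [aeval_eq_sum_range, Matrix.transpose_sum, Matrix.transpose_smul,
        Matrix.transpose_pow]
    have h2 := aeval_algHom_apply (Matrix.toLinAlgEquiv' : Matrix (Fin n) (Fin n) ℝ ≃ₐ[ℝ] _)
      M.transpose (minpoly ℝ M)
    rw [h1, map_zero] at h2
    exact h2
  have := D.equiv_aeval (minpoly ℝ M) (D.gen i) i
  rw [h0] at this
  simpa [gen] using this.symm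

lemma exists_aeval_eq_nil (h : (RCLike.I : 𝕜) ≠ 0 → RCLike.im lam ≠ 0) :
    ∃ r : ℝ[X], aeval (Matrix.toLin' M.transpose) r = D.nil := by
  obtain ⟨r, hr⟩ := exists_real_polynomial lam h (eigenIndex M lam)
  refine ⟨r, LinearMap.ext fun x => D.equiv.injective (funext fun i => ?_)⟩
  rw [equiv_aeval, equiv_nil, LocAlg.e]
  congr 1
  rw [← sub_eq_zero, ← map_sub, AdjoinRoot.mk_eq_zero]
  exact (pow_dvd_pow _ (D.size_le_eigenIndex i)).trans hr

/-- In the summands of D_k the vector x - ρπx has no constant coefficient, so it supplies one more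
factor e. The other summands have exponent at most l-1-k and are killed by e^(l-1-k). -/
lemma exists_nil_pow_eq (l k : ℕ) (hk : k < l) (x : Fin n → ℝ) :
    ∃ y, (D.nil ^ (l - 1 - k)) (x - D.retr l k x) = (D.nil ^ (l - k)) y := by
  have h : ∀ i, ∃ b, LocAlg.e lam _ ^ (l - 1 - k) * D.equiv (x - D.retr l k x) i =
      LocAlg.e lam (D.size i) ^ (l - k) * b := by
    intro i
    by_cases hi : l ≤ D.size i + k
    · have : LocAlg.coeff 0 (D.equiv (x - D.retr l k x) i) = 0 := by
        rw [map_sub, Pi.sub_apply, ← LocAlg.coeffₗ_apply, map_sub, LocAlg.coeffₗ_apply,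
          LocAlg.coeffₗ_apply, retr, sect, LinearEquiv.apply_symm_apply, dif_pos hi, proj,
          LocAlg.coeff_zero_algebraMap (D.size_pos i), sub_self]
      obtain ⟨b, hb⟩ := LocAlg.exists_eq_e_mul (D.size_pos i) _ this
      refine ⟨b, ?_⟩
      rw [hb, ← mul_assoc, ← pow_succ]
      congr 2; omega
    · refine ⟨0, ?_⟩
      rw [pow_eq_zero_of_le (by omega) (LocAlg.e_pow_self (D.size i)), zero_mul, mul_zero]
  choose b hb using h
  refine ⟨D.equiv.symm b, D.equiv.injective (funext fun i => ?_)⟩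
  rw [equiv_nil_pow, equiv_nil_pow, hb, LinearEquiv.apply_symm_apply]

lemma nil_pow_eq_zero {l : ℕ} (hl : ∀ i, D.size i ≤ l) (x : Fin n → ℝ) : (D.nil ^ l) x = 0 := by
  refine D.equiv.injective (funext fun i => ?_)
  rw [equiv_nil_pow, pow_eq_zero_of_le (hl i) (LocAlg.e_pow_self (D.size i)), zero_mul]
  simp

end CyclicDecomposition

lemma HasSingleEigenvalue.pos {𝕜 : Type*} [RCLike 𝕜] {n : ℕ} {M : Matrix (Fin n) (Fin n) ℝ}
    {lam : 𝕜} (hM : HasSingleEigenvalue M lam) : 0 < n := by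
  by_contra h
  obtain rfl : n = 0 := by omega
  obtain ⟨v, -, hv⟩ := ((hM.2 _).mpr (Or.inl rfl)).exists_hasEigenvector
  exact hv (Subsingleton.elim _ _)

lemma CyclicDecomposition.count_pos {𝕜 : Type*} [RCLike 𝕜] {n : ℕ}
    {M : Matrix (Fin n) (Fin n) ℝ} {lam : 𝕜} (D : CyclicDecomposition M lam) (hn : 0 < n) :
    0 < D.count := by
  by_contra h
  have : IsEmpty (Fin D.count) := by
    rw [Nat.eq_zero_of_not_pos h]; infer_instance
  have := D.equiv.injective.subsingleton
  have : Nonempty (Fin n) := ⟨⟨0, hn⟩⟩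
  exact not_subsingleton (Fin n → ℝ) inferInstance

open Filter Topology Set

/-! ### Continuous extensions and the classes C^m on a closure -/

section ExtendFrom

variable {X Y : Type*} [TopologicalSpace X] [TopologicalSpace Y]

lemma extendFrom_congr {A : Set X} {f g : X → Y} (h : EqOn f g A) :
    extendFrom A f = extendFrom A g := by
  funext x
  have : Filter.map f (𝓝[A] x) = Filter.map g (𝓝[A] x) :=
    Filter.map_congr (eventually_nhdsWithin_of_forall h)
  simp only [extendFrom, limUnder, this]

lemma extendFrom_eq_of_continuousOn [T2Space Y] {A : Set X} {f g : X → Y}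
    (hg : ContinuousOn g (closure A)) (h : EqOn g f A) {x : X} (hx : x ∈ closure A) :
    extendFrom A f x = g x := by
  rw [← extendFrom_congr h]
  exact extendFrom_eq hx ((hg x hx).mono subset_closure)

lemma continuousOn_extendFrom_of_continuousOn [T2Space Y] {A : Set X} {f g : X → Y}
    (hg : ContinuousOn g (closure A)) (h : EqOn g f A) :
    ContinuousOn (extendFrom A f) (closure A) :=
  hg.congr fun _ hx => extendFrom_eq_of_continuousOn hg h hx

end ExtendFrom

section CkClosure

variable {𝕜 : Type*} [RCLike 𝕜] {E F G : Type*} [NormedAddCommGroup E] [NormedSpace 𝕜 E]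
  [NormedAddCommGroup F] [NormedSpace 𝕜 F] [NormedAddCommGroup G] [NormedSpace 𝕜 G]
  {V : Set E} {f g : E → F} {m k : ℕ}

lemma CkClosure.zero (hf : ContinuousOn f (closure V)) : CkClosure 𝕜 0 V f where
  continuousOn := hf
  contDiffOn := contDiffOn_zero.mpr (hf.mono subset_closure)
  extends_iteratedFDeriv j hj := by
    obtain rfl : j = 0 := by omega
    refine ⟨fun x => (continuousMultilinearCurryFin0 𝕜 E F).symm (f x),
      (LinearIsometryEquiv.continuous _).comp_continuousOn hf, fun x _ => ?_⟩
    rw [iteratedFDeriv_zero_eq_comp]; rfl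

/-- Allows regularity up to the boundary to be proved by induction from a formula for the first
derivative alone. -/
lemma CkClosure.succ (hV : IsOpen V) {f' : E → E →L[𝕜] F} (hf : ContinuousOn f (closure V))
    (hd : ∀ x ∈ V, HasFDerivAt f (f' x) x) (hf' : CkClosure 𝕜 m V f') :
    CkClosure 𝕜 (m + 1) V f where
  continuousOn := hf
  contDiffOn := by
    have := (contDiffOn_succ_iff_fderiv_of_isOpen (n := (m : WithTop ℕ∞)) (f := f) (𝕜 := 𝕜) hV).mpr
      ⟨fun x hx => (hd x hx).differentiableAt.differentiableWithinAt, by simp,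
        hf'.contDiffOn.congr fun x hx => (hd x hx).fderiv⟩
    exact_mod_cast this
  extends_iteratedFDeriv j hj := by
    cases j with
    | zero =>
      exact (CkClosure.zero (𝕜 := 𝕜) hf).extends_iteratedFDeriv 0 le_rfl
    | succ j =>
      obtain ⟨g, hg, hgV⟩ := hf'.extends_iteratedFDeriv j (by omega)
      refine ⟨fun x => (continuousMultilinearCurryRightEquiv' 𝕜 j E F).symm (g x),
        (LinearIsometryEquiv.continuous _).comp_continuousOn hg, fun x hx => ?_⟩
      rw [iteratedFDeriv_succ_eq_comp_right, Function.comp_apply]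
      simp only
      rw [hgV hx]
      congr 1
      refine (Filter.EventuallyEq.iteratedFDeriv 𝕜 ?_ j).eq_of_nhds
      filter_upwards [hV.mem_nhds hx] with y hy using ((hd y hy).fderiv).symm

lemma CkClosure.add (hV : IsOpen V) (hf : CkClosure 𝕜 m V f) (hg : CkClosure 𝕜 m V g) :
    CkClosure 𝕜 m V (fun x => f x + g x) where
  continuousOn := hf.continuousOn.add hg.continuousOn
  contDiffOn := hf.contDiffOn.add hg.contDiffOn
  extends_iteratedFDeriv j hj := by
    obtain ⟨a, ha, haV⟩ := hf.extends_iteratedFDeriv j hj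
    obtain ⟨b, hb, hbV⟩ := hg.extends_iteratedFDeriv j hj
    refine ⟨fun x => a x + b x, ha.add hb, fun x hx => ?_⟩
    have hj' : (j : WithTop ℕ∞) ≤ m := by exact_mod_cast hj
    rw [fun_iteratedFDeriv_add_apply ((hf.contDiffOn.contDiffAt (hV.mem_nhds hx)).of_le hj')
      ((hg.contDiffOn.contDiffAt (hV.mem_nhds hx)).of_le hj')]
    simp only
    rw [haV hx, hbV hx]

lemma CkClosure.clm_comp (hV : IsOpen V) (L : F →L[𝕜] G) (hf : CkClosure 𝕜 m V f) :
    CkClosure 𝕜 m V (fun x => L (f x)) where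
  continuousOn := L.continuous.comp_continuousOn hf.continuousOn
  contDiffOn := L.contDiff.comp_contDiffOn hf.contDiffOn
  extends_iteratedFDeriv j hj := by
    obtain ⟨a, ha, haV⟩ := hf.extends_iteratedFDeriv j hj
    refine ⟨fun x => ContinuousLinearMap.compContinuousMultilinearMapL 𝕜 (fun _ : Fin j => E) F G L
      (a x), (ContinuousLinearMap.continuous _).comp_continuousOn ha, fun x hx => ?_⟩
    have hj' : (j : WithTop ℕ∞) ≤ m := by exact_mod_cast hj
    have := L.iteratedFDeriv_comp_left (hf.contDiffOn.contDiffAt (hV.mem_nhds hx)) hj'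
    simp only
    rw [haV hx]
    exact this.symm

lemma CkClosure.sum (hV : IsOpen V) {ι : Type*} (s : Finset ι) {h : ι → E → F}
    (hh : ∀ i ∈ s, CkClosure 𝕜 m V (h i)) : CkClosure 𝕜 m V (fun x => ∑ i ∈ s, h i x) := by
  classical
  induction s using Finset.induction_on with
  | empty =>
    refine ⟨by simpa using continuousOn_const, by simpa using contDiffOn_const, fun j _ =>
      ⟨0, continuousOn_const, fun x _ => ?_⟩⟩
    simp only [Finset.sum_empty]
    rw [show (fun _ : E => (0 : F)) = 0 from rfl]
    simp
  | insert i s hi ih =>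
    simp only [Finset.sum_insert hi]
    exact (hh i (by simp)).add hV (ih fun k hk => hh k (by simp [hk]))

/-- The first derivative of a function of class `C^k(closure V)`, extended to `closure V`. -/
lemma CkClosure.exists_fderiv (hf : CkClosure 𝕜 m V f) (hm : 1 ≤ m) :
    ∃ f' : E → E →L[𝕜] F, ContinuousOn f' (closure V) ∧ EqOn f' (fderiv 𝕜 f) V := by
  obtain ⟨g, hg, hgV⟩ := hf.extends_iteratedFDeriv 1 hm
  refine ⟨fun x => continuousMultilinearCurryFin1 𝕜 E F (g x),
    (LinearIsometryEquiv.continuous _).comp_continuousOn hg, fun x hx => ?_⟩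
  ext w
  simp only
  rw [hgV hx]
  simp [iteratedFDeriv_one_apply]

end CkClosure

/-! ### Functions constant along segments -/

section Segment

variable {E F : Type*} [NormedAddCommGroup E] [NormedSpace ℝ E] [NormedAddCommGroup F]
  [NormedSpace ℝ F] {U : Set E}

/-- The endpoint b may lie on the boundary, as slice points do. By convexity the segment without b
stays in the open set, and continuity on the closure covers b. -/
lemma eq_of_hasFDerivAt_apply_eq_zero (hU : Convex ℝ U) (hUo : IsOpen U) {h : E → F}
    {h' : E → E →L[ℝ] F} (hc : ContinuousOn h (closure U)) (hd : ∀ x ∈ U, HasFDerivAt h (h' x) x)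
    {u b : E} (hu : u ∈ U) (hb : b ∈ closure U) (h0 : ∀ x ∈ U, h' x (b - u) = 0) :
    h u = h b := by
  have hmem : ∀ s ∈ Ico (0 : ℝ) 1, u + s • (b - u) ∈ U := by
    intro s hs
    have := hU.add_smul_sub_mem_interior' hb (y := u) (by rwa [hUo.interior_eq]) (t := 1 - s)
      ⟨by linarith [hs.2], by linarith [hs.1]⟩
    rw [hUo.interior_eq] at this
    convert this using 1
    module
  have hcl : ∀ s ∈ Icc (0 : ℝ) 1, u + s • (b - u) ∈ closure U := by
    intro s hs
    rcases hs.2.eq_or_lt with rfl | h1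
    · simpa using hb
    · exact subset_closure (hmem s ⟨hs.1, h1⟩)
  have key := constant_of_has_deriv_right_zero (f := fun s : ℝ => h (u + s • (b - u)))
    (a := 0) (b := 1)
    (hc.comp (by fun_prop) hcl) (fun s hs => by
      have h1 : HasDerivAt (fun s : ℝ => u + s • (b - u)) (b - u) s := by
        simpa using ((hasDerivAt_id s).smul_const (b - u)).const_add u
      have := (hd _ (hmem s hs)).comp_hasDerivAt s h1
      rw [h0 _ (hmem s hs)] at this
      exact this.hasDerivWithinAt) 1 (by simp)
  simpa using key.symm

end Segment

/-! ### Iterated partial derivatives up to the boundary -/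

section DirDeriv

variable {𝕜 : Type*} [RCLike 𝕜] {ι : Type*} [Fintype ι] [DecidableEq ι]

/-- The iterated partial derivative of `f`, with respect to the coordinates listed in `p`. -/
def dirDeriv (f : (ι → 𝕜) → 𝕜) : List ι → (ι → 𝕜) → 𝕜
  | [] => f
  | c :: p => fun z => fderiv 𝕜 (dirDeriv f p) z (Pi.single c 1)

variable {f : (ι → 𝕜) → 𝕜} {V : Set (ι → 𝕜)} {K : ℕ}

lemma contDiffOn_dirDeriv (hV : IsOpen V) (hf : ContDiffOn 𝕜 K f V) (p : List ι) (m : ℕ)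
    (h : p.length + m ≤ K) : ContDiffOn 𝕜 m (dirDeriv f p) V := by
  induction p generalizing m with
  | nil => exact hf.of_le (by exact_mod_cast (by simpa using h))
  | cons c p ih =>
    have h1 := ih (m + 1) (by simp at h; omega)
    exact (h1.fderiv_of_isOpen hV (by simp)).clm_apply contDiffOn_const

lemma hasFDerivAt_dirDeriv (hV : IsOpen V) (hf : ContDiffOn 𝕜 K f V) (p : List ι)
    (h : p.length < K) {z : ι → 𝕜} (hz : z ∈ V) :
    HasFDerivAt (dirDeriv f p)
      (∑ c, (ContinuousLinearMap.proj c : (ι → 𝕜) →L[𝕜] 𝕜).smulRight (dirDeriv f (c :: p) z)) z := by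
  have h1 : ContDiffOn 𝕜 1 (dirDeriv f p) V := contDiffOn_dirDeriv hV hf p 1 h
  have h2 := ((h1.contDiffAt (hV.mem_nhds hz)).differentiableAt one_ne_zero).hasFDerivAt
  suffices h3 : ∑ c, (ContinuousLinearMap.proj c : (ι → 𝕜) →L[𝕜] 𝕜).smulRight
      (dirDeriv f (c :: p) z) = fderiv 𝕜 (dirDeriv f p) z from h3 ▸ h2
  refine ContinuousLinearMap.ext fun w => ?_
  conv_rhs => rw [← Finset.univ_sum_single w]
  rw [map_sum, _root_.sum_apply]
  refine Finset.sum_congr rfl fun c _ => ?_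
  have : (Pi.single c (w c) : ι → 𝕜) = w c • Pi.single c 1 := by
    rw [← Pi.single_smul, smul_eq_mul, mul_one]
  rw [this, map_smul]
  rfl

/-- Permutations are generated by swaps of neighbours, where this is the symmetry of the second
derivative. -/
lemma dirDeriv_perm (hV : IsOpen V) (hf : ContDiffOn 𝕜 K f V) {p q : List ι} (hpq : p.Perm q)
    (h : p.length ≤ K) : EqOn (dirDeriv f p) (dirDeriv f q) V := by
  induction hpq with
  | nil => exact fun _ _ => rfl
  | cons c hpq ih =>
    intro z hz
    have := ih (by simp at h; omega)
    change fderiv 𝕜 _ z _ = fderiv 𝕜 _ z _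
    rw [(this.eventuallyEq_of_mem (hV.mem_nhds hz)).fderiv_eq]
  | swap c d p =>
    intro z hz
    have h1 : ContDiffAt 𝕜 2 (dirDeriv f p) z :=
      (contDiffOn_dirDeriv hV hf p 2 (by simp at h; omega)).contDiffAt (hV.mem_nhds hz)
    have h2 : DifferentiableAt 𝕜 (fderiv 𝕜 (dirDeriv f p)) z :=
      (h1.fderiv_right (m := 1) (by norm_num)).differentiableAt one_ne_zero
    have h3 := h1.isSymmSndFDerivAt (by simp)
    simp only [dirDeriv]
    rw [fderiv_clm_apply h2 (differentiableAt_const _),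
      fderiv_clm_apply h2 (differentiableAt_const _)]
    simpa using h3 _ _
  | trans hpq hqr ih1 ih2 =>
    exact (ih1 h).trans (ih2 (hpq.length_eq ▸ h))

lemma iteratedFDeriv_eq_dirDeriv (hV : IsOpen V) (hf : ContDiffOn 𝕜 K f V) {j : ℕ} (hj : j ≤ K)
    (i : Fin j → ι) : EqOn (fun z => iteratedFDeriv 𝕜 j f z (fun r => Pi.single (i r) 1))
      (dirDeriv f (List.ofFn i)) V := by
  induction j with
  | zero => intro z _; simp [dirDeriv]
  | succ j ih =>
    intro z hz
    have h1 := (ih (by omega) (fun r => i r.succ)).eventuallyEq_of_mem (hV.mem_nhds hz)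
    simp only [List.ofFn_succ, dirDeriv]
    rw [← h1.fderiv_eq, iteratedFDeriv_succ_apply_left]
    have h2 : DifferentiableAt 𝕜 (iteratedFDeriv 𝕜 j f) z :=
      (hf.contDiffAt (hV.mem_nhds hz)).differentiableAt_iteratedFDeriv (by exact_mod_cast hj)
    rw [fderiv_continuousMultilinear_apply_const_apply h2]
    rfl

lemma continuousOn_extendFrom_dirDeriv (hV : IsOpen V) (hf : CkClosure 𝕜 K V f) (p : List ι)
    (h : p.length ≤ K) : ContinuousOn (extendFrom V (dirDeriv f p)) (closure V) := by
  obtain ⟨g, hg, hgV⟩ := hf.extends_iteratedFDeriv p.length h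
  refine continuousOn_extendFrom_of_continuousOn
    (g := fun z => g z (fun r => Pi.single (p.get r) 1)) ?_ ?_
  · exact (ContinuousMultilinearMap.apply 𝕜 _ 𝕜 _).continuous.comp_continuousOn hg
  · intro z hz
    have := iteratedFDeriv_eq_dirDeriv hV hf.contDiffOn h p.get hz
    rw [List.ofFn_get] at this
    rw [← this]
    simp only
    rw [hgV hz]

lemma extendFrom_iteratedFDeriv_apply (hV : IsOpen V) (hf : CkClosure 𝕜 K V f) {j : ℕ}
    (hj : j ≤ K) (i : Fin j → ι) {z : ι → 𝕜} (hz : z ∈ closure V) :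
    extendFrom V (iteratedFDeriv 𝕜 j f) z (fun r => Pi.single (i r) 1) =
      extendFrom V (dirDeriv f (List.ofFn i)) z := by
  obtain ⟨g, hg, hgV⟩ := hf.extends_iteratedFDeriv j hj
  rw [extendFrom_eq_of_continuousOn hg hgV hz,
    ← extendFrom_congr (iteratedFDeriv_eq_dirDeriv hV hf.contDiffOn hj i)]
  symm
  refine extendFrom_eq_of_continuousOn (g := fun z => g z (fun r => Pi.single (i r) 1)) ?_ ?_ hz
  · exact (ContinuousMultilinearMap.apply 𝕜 _ 𝕜 _).continuous.comp_continuousOn hg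
  · intro y hy
    simp only
    rw [hgV hy]

end DirDeriv

lemma CkClosure.congr {𝕜 : Type*} [RCLike 𝕜] {E F : Type*} [NormedAddCommGroup E]
    [NormedSpace 𝕜 E] [NormedAddCommGroup F] [NormedSpace 𝕜 F] {V : Set E} {f g : E → F} {m : ℕ}
    (hV : IsOpen V) (hf : CkClosure 𝕜 m V f) (h : EqOn g f (closure V)) : CkClosure 𝕜 m V g where
  continuousOn := hf.continuousOn.congr h
  contDiffOn := hf.contDiffOn.congr (h.mono subset_closure)
  extends_iteratedFDeriv j hj := by
    obtain ⟨a, ha, haV⟩ := hf.extends_iteratedFDeriv j hj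
    refine ⟨a, ha, fun x hx => ?_⟩
    rw [haV hx]
    exact ((((h.mono subset_closure).eventuallyEq_of_mem
      (hV.mem_nhds hx)).iteratedFDeriv 𝕜 j).eq_of_nhds).symm

/-! ### Taylor polynomials with nilpotent increments -/

section TaylorSum

variable {E A ι : Type*} [NormedAddCommGroup E] [NormedSpace ℝ E] [NormedCommRing A]
  [NormedAlgebra ℝ A] [Fintype ι]

/-- The linear map `w ↦ a * ℓ w`, as a function of `a`. -/
def mulLeftL (ℓ : E →L[ℝ] A) : A →L[ℝ] E →L[ℝ] A :=
  ((ContinuousLinearMap.compL ℝ E A A).flip ℓ).comp (ContinuousLinearMap.mul ℝ A)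

@[simp] lemma mulLeftL_apply (ℓ : E →L[ℝ] A) (a : A) (w : E) : mulLeftL ℓ a w = a * ℓ w := rfl

/-- `∑ eps_{c_1}(u) ⋯ eps_{c_j}(u) G_{c_j, …, c_1, p}(u)`, the sum over all `c_1, …, c_j`. -/
def taylorTerm (G : List ι → E → A) (eps : ι → E →L[ℝ] A) : ℕ → List ι → E → A
  | 0, p => G p
  | j + 1, p => fun u => ∑ c, eps c u * taylorTerm G eps j (c :: p) u

/-- The Taylor polynomial `κ ∑_{j ≤ L} 1 / j! ∑ eps_{c_1}(u) ⋯ eps_{c_j}(u) G_{c_j, …, c_1, p}(u)`. -/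
def taylorSum (G : List ι → E → A) (eps : ι → E →L[ℝ] A) (κ : A) (L : ℕ) (p : List ι) (u : E) : A :=
  κ * ∑ j ∈ Finset.range (L + 1), (j.factorial : ℝ)⁻¹ • taylorTerm G eps j p u

variable {G : List ι → E → A} {eps coord : ι → E →L[ℝ] A} {K L j : ℕ} {U : Set E}

lemma taylorTerm_perm (hG : ∀ p q : List ι, p.Perm q → p.length ≤ K → G p = G q) {p q : List ι}
    (hpq : p.Perm q) (h : j + p.length ≤ K) : taylorTerm G eps j p = taylorTerm G eps j q := by
  induction j generalizing p q with
  | zero => exact hG p q hpq (by omega)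
  | succ j ih =>
    funext u
    exact Finset.sum_congr rfl fun c _ => by rw [ih (hpq.cons c) (by simp; omega)]

lemma taylorTerm_eq_sum (hG : ∀ p q : List ι, p.Perm q → p.length ≤ K → G p = G q) {p : List ι}
    (h : j + p.length ≤ K) (u : E) :
    taylorTerm G eps j p u =
      ∑ i : Fin j → ι, (∏ r, eps (i r) u) * G (List.ofFn i ++ p) u := by
  induction j generalizing p with
  | zero => simp [taylorTerm]
  | succ j ih =>
    rw [← (Fin.consEquiv fun _ : Fin (j + 1) => ι).sum_comp, Fintype.sum_prod_type]
    refine Finset.sum_congr rfl fun c _ => ?_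
    rw [ih (by simp; omega), Finset.mul_sum]
    refine Finset.sum_congr rfl fun i _ => ?_
    -- The recursion puts the first index c innermost in the list; symmetry brings it back to the
    -- front.
    rw [hG (List.ofFn i ++ c :: p) (c :: (List.ofFn i ++ p)) List.perm_middle
      (by simp; omega)]
    simp [Fin.consEquiv, Fin.prod_univ_succ, List.ofFn_succ, mul_assoc]

lemma continuousOn_taylorTerm (hG : ∀ p : List ι, p.length ≤ K → ContinuousOn (G p) U)
    {p : List ι} (h : j + p.length ≤ K) : ContinuousOn (taylorTerm G eps j p) U := by
  induction j generalizing p with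
  | zero => exact hG p (by omega)
  | succ j ih =>
    exact continuousOn_finsetSum _ fun c _ =>
      (eps c).continuous.continuousOn.mul (ih (by simp; omega))

lemma continuousOn_taylorSum (hG : ∀ p : List ι, p.length ≤ K → ContinuousOn (G p) U)
    {p : List ι} (h : L + p.length ≤ K) (κ : A) :
    ContinuousOn (taylorSum G eps κ L p) U :=
  continuousOn_const.mul (continuousOn_finsetSum _ fun j hj =>
    (continuousOn_taylorTerm hG (by simp at hj; omega)).const_smul _)

lemma taylorSum_of_eps_eq_zero {u : E} (h : ∀ c, eps c u = 0) (κ : A) (p : List ι) :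
    taylorSum G eps κ L p u = κ * G p u := by
  rw [taylorSum, Finset.sum_eq_single_of_mem 0 (by simp)]
  · simp [taylorTerm]
  · intro j _ hj
    obtain ⟨j, rfl⟩ := Nat.exists_eq_succ_of_ne_zero hj
    simp [taylorTerm, h]

lemma pow_dvd_taylorTerm {e : A} (he : ∀ c w, e ∣ eps c w) (p : List ι) (u : E) :
    e ^ j ∣ taylorTerm G eps j p u := by
  induction j generalizing p with
  | zero => simp
  | succ j ih =>
    rw [pow_succ']
    exact Finset.dvd_sum fun c _ => mul_dvd_mul (he c u) (ih _)

/-- Product rule: differentiating G gives the `coord` part, and by symmetry the j factors `eps`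
contribute equally. At j = 0 the truncated `j - 1` is harmless because of the factor j. -/
lemma hasFDerivAt_taylorTerm (hG : ∀ p q : List ι, p.Perm q → p.length ≤ K → G p = G q) {u : E}
    (hd : ∀ p : List ι, p.length < K →
      HasFDerivAt (G p) (∑ c, mulLeftL (coord c) (G (c :: p) u)) u)
    {p : List ι} (h : j + p.length < K) :
    HasFDerivAt (taylorTerm G eps j p)
      (∑ c, (mulLeftL (coord c) (taylorTerm G eps j (c :: p) u) +
        (j : ℝ) • mulLeftL (eps c) (taylorTerm G eps (j - 1) (c :: p) u))) u := by
  induction j generalizing p with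
  | zero =>
    refine (hd p (by omega)).congr_fderiv (ContinuousLinearMap.ext fun w => ?_)
    simp [sum_apply, taylorTerm]
  | succ j ih =>
    have h1 : ∀ c ∈ Finset.univ, HasFDerivAt (fun u => eps c u * taylorTerm G eps j (c :: p) u) _ u :=
      fun c _ => (eps c).hasFDerivAt.mul (ih (p := c :: p) (by simp; omega))
    refine (HasFDerivAt.fun_sum h1).congr_fderiv (ContinuousLinearMap.ext fun w => ?_)
    have e1 : ∑ c, eps c u * ∑ d, taylorTerm G eps j (d :: c :: p) u * coord d w =
        ∑ d, taylorTerm G eps (j + 1) (d :: p) u * coord d w := by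
      simp_rw [Finset.mul_sum]
      rw [Finset.sum_comm]
      refine Finset.sum_congr rfl fun d _ => ?_
      rw [taylorTerm, Finset.sum_mul]
      refine Finset.sum_congr rfl fun c _ => ?_
      rw [taylorTerm_perm hG (List.Perm.swap c d p) (by simp; omega), mul_assoc]
    have e2 : ∑ c, eps c u * ∑ d, (j : ℝ) • (taylorTerm G eps (j - 1) (d :: c :: p) u * eps d w) =
        ∑ d, (j : ℝ) • (taylorTerm G eps j (d :: p) u * eps d w) := by
      cases j with
      | zero => simp
      | succ j =>
        simp_rw [Finset.mul_sum]
        rw [Finset.sum_comm]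
        refine Finset.sum_congr rfl fun d _ => ?_
        rw [taylorTerm, Finset.sum_mul, Finset.smul_sum]
        refine Finset.sum_congr rfl fun c _ => ?_
        rw [Nat.add_sub_cancel, taylorTerm_perm hG (List.Perm.swap c d p) (by simp; omega),
          mul_smul_comm, mul_assoc]
    simp only [sum_apply, add_apply, smul_apply, mulLeftL_apply, smul_eq_mul,
      Finset.sum_add_distrib, mul_add, e1, e2, Nat.add_sub_cancel, Nat.cast_add, Nat.cast_one,
      add_smul, one_smul, add_assoc]

/-- The `eps` part in degree j matches the one missing in degree j-1, so `coord` and `eps` acquire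
the same coefficients. The only defect is in top degree L, and κ e^(L+1) = 0 removes it. -/
lemma hasFDerivAt_taylorSum (hG : ∀ p q : List ι, p.Perm q → p.length ≤ K → G p = G q) {u : E}
    (hd : ∀ p : List ι, p.length < K →
      HasFDerivAt (G p) (∑ c, mulLeftL (coord c) (G (c :: p) u)) u)
    {e κ : A} (he : ∀ c w, e ∣ eps c w) (hκ : κ * e ^ (L + 1) = 0)
    {p : List ι} (h : L + p.length < K) :
    HasFDerivAt (taylorSum G eps κ L p)
      (∑ c, mulLeftL (coord c + eps c) (taylorSum G eps κ L (c :: p) u)) u := by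
  have h1 : ∀ j ∈ Finset.range (L + 1),
      HasFDerivAt (fun u => (j.factorial : ℝ)⁻¹ • taylorTerm G eps j p u) _ u :=
    fun j hj => (hasFDerivAt_taylorTerm (eps := eps) hG hd (j := j) (p := p)
      (by simp at hj; omega)).fun_const_smul _
  refine ((HasFDerivAt.fun_sum h1).const_mul κ).congr_fderiv (ContinuousLinearMap.ext fun w => ?_)
  set a : ℕ → A := fun j => ∑ c, taylorTerm G eps j (c :: p) u * coord c w with ha
  set b : ℕ → A := fun j => ∑ c, taylorTerm G eps j (c :: p) u * eps c w with hb
  -- L factors e come from the Taylor term and one more from `eps c w`.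
  have hbL : κ * b L = 0 := by
    rw [hb, Finset.mul_sum]
    refine Finset.sum_eq_zero fun c _ => ?_
    obtain ⟨x, hx⟩ := pow_dvd_taylorTerm (G := G) he (c :: p) u (j := L)
    obtain ⟨y, hy⟩ := he c w
    rw [hx, hy]
    linear_combination x * y * hκ
  have hleft : ∑ j ∈ Finset.range (L + 1), (j.factorial : ℝ)⁻¹ • ((j : ℝ) • b (j - 1)) =
      ∑ j ∈ Finset.range L, (j.factorial : ℝ)⁻¹ • b j := by
    rw [Finset.sum_range_succ']
    simp only [Nat.add_sub_cancel, Nat.cast_zero, zero_smul, smul_zero, add_zero]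
    refine Finset.sum_congr rfl fun j _ => ?_
    rw [smul_smul, Nat.factorial_succ]
    congr 1
    have : (j.factorial : ℝ) ≠ 0 := by exact_mod_cast j.factorial_ne_zero
    push_cast
    field_simp
  have hL : κ * ∑ j ∈ Finset.range (L + 1), (j.factorial : ℝ)⁻¹ • (a j + (j : ℝ) • b (j - 1)) =
      κ * ∑ j ∈ Finset.range (L + 1), (j.factorial : ℝ)⁻¹ • (a j + b j) := by
    simp only [smul_add, Finset.sum_add_distrib]
    rw [hleft, Finset.sum_range_succ (fun j => (j.factorial : ℝ)⁻¹ • b j), mul_add, mul_add,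
      mul_add, mul_smul_comm, hbL, smul_zero, add_zero]
  have hl : ∀ j, (∑ c, (mulLeftL (coord c) (taylorTerm G eps j (c :: p) u) +
      (j : ℝ) • mulLeftL (eps c) (taylorTerm G eps (j - 1) (c :: p) u))) w =
      a j + (j : ℝ) • b (j - 1) := by
    intro j
    simp [ha, hb, sum_apply, Finset.sum_add_distrib, Finset.smul_sum]
  simp only [sum_apply, smul_apply, hl, mulLeftL_apply, taylorSum, smul_eq_mul, add_apply]
  rw [hL]
  simp only [ha, hb, ← Finset.sum_add_distrib, ← mul_add, Finset.smul_sum, mul_assoc,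
    Finset.sum_mul, ← Finset.mul_sum]
  rw [Finset.sum_comm]
  simp only [smul_mul_assoc]

/-- Each differentiation lengthens p by one and leaves the degree L unchanged, so t of them need
only G on lists of length up to t + L. -/
lemma CkClosure.taylorSum (hU : IsOpen U) {e κ : A} {t : ℕ}
    (hG : ∀ p q : List ι, p.Perm q → p.length ≤ t + L → G p = G q)
    (hd : ∀ u ∈ U, ∀ p : List ι, p.length < t + L →
      HasFDerivAt (G p) (∑ c, mulLeftL (coord c) (G (c :: p) u)) u)
    (hc : ∀ p : List ι, p.length ≤ t + L → ContinuousOn (G p) (closure U))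
    (he : ∀ c w, e ∣ eps c w) (hκ : κ * e ^ (L + 1) = 0) {m : ℕ}
    {p : List ι} (h : m + p.length ≤ t) :
    CkClosure ℝ m U (taylorSum G eps κ L p) := by
  induction m generalizing p with
  | zero => exact .zero (continuousOn_taylorSum hc (by omega) κ)
  | succ m ih =>
    exact .succ hU (continuousOn_taylorSum hc (by omega) κ)
      (fun u hu => hasFDerivAt_taylorSum hG (hd u hu) he hκ (by omega))
      (.sum hU _ fun c _ => (ih (p := c :: p) (by simp; omega)).clm_comp hU _)

end TaylorSum

/-! ### An auxiliary norm on the algebra, for differentiating A-valued maps -/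

section Norm

variable {𝕜 : Type*} [RCLike 𝕜]

/-- The left regular representation of `𝕜[X] / (X - lam) ^ l`. -/
def LocAlg.regularRep (lam : 𝕜) (l : ℕ) :
    LocAlg lam l →ₐ[ℝ] Matrix (Fin (AdjoinRoot.powerBasis' ((monic_X_sub_C lam).pow l)).dim)
      (Fin (AdjoinRoot.powerBasis' ((monic_X_sub_C lam).pow l)).dim) 𝕜 :=
  (Algebra.leftMulMatrix (AdjoinRoot.powerBasis' ((monic_X_sub_C lam).pow l)).basis).restrictScalars
    ℝ

lemma LocAlg.regularRep_injective (lam : 𝕜) (l : ℕ) :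
    Function.Injective (LocAlg.regularRep lam l) := fun _ _ h =>
  Algebra.leftMulMatrix_injective (AdjoinRoot.powerBasis' ((monic_X_sub_C lam).pow l)).basis h

attribute [local instance] Matrix.linftyOpNormedRing Matrix.linftyOpNormedAlgebra

/-- An auxiliary submultiplicative norm on `𝕜[X] / (X - lam) ^ l`. -/
@[reducible] def LocAlg.normedCommRing (lam : 𝕜) (l : ℕ) : NormedCommRing (LocAlg lam l) :=
  NormedCommRing.induced (LocAlg lam l) _ (LocAlg.regularRep lam l)
    (LocAlg.regularRep_injective lam l)

attribute [local instance] LocAlg.normedCommRing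

/-- The real normed algebra structure for `LocAlg.normedCommRing`. -/
@[reducible] def LocAlg.normedAlgebra (lam : 𝕜) (l : ℕ) : NormedAlgebra ℝ (LocAlg lam l) :=
  NormedAlgebra.induced ℝ (LocAlg lam l) _ (LocAlg.regularRep lam l)

end Norm

attribute [local instance] LocAlg.normedCommRing LocAlg.normedAlgebra

instance LocAlg.finiteDimensional {𝕜 : Type*} [RCLike 𝕜] (lam : 𝕜) (l : ℕ) :
    FiniteDimensional ℝ (LocAlg lam l) :=
  have : Module.Finite 𝕜 (LocAlg lam l) := ((monic_X_sub_C lam).pow l).finite_adjoinRoot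
  Module.Finite.trans 𝕜 _

/-! ### The summands of T as A-valued Taylor polynomials -/

namespace CyclicDecomposition

variable {𝕜 : Type*} [RCLike 𝕜] {n : ℕ} {M : Matrix (Fin n) (Fin n) ℝ} {lam : 𝕜}
  (D : CyclicDecomposition M lam)

/-- `proj` as a continuous linear map. -/
def projL (l k : ℕ) : (Fin n → ℝ) →L[ℝ] (D.Idx l k → 𝕜) :=
  LinearMap.toContinuousLinearMap (LinearMap.pi fun i =>
    ((LocAlg.coeffₗ lam (D.size i.1) 0).restrictScalars ℝ).comp
      ((LinearMap.proj i.1).comp D.equiv.toLinearMap))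

@[simp] lemma projL_apply (l k : ℕ) (u : Fin n → ℝ) : D.projL l k u = D.proj l k u := rfl

lemma proj_sect (l k : ℕ) (z : D.Idx l k → 𝕜) : D.proj l k (D.sect l k z) = z := by
  funext i
  rw [proj, sect, LinearEquiv.apply_symm_apply, dif_pos i.2,
    LocAlg.coeff_zero_algebraMap (D.size_pos _)]

lemma proj_retr (l k : ℕ) (u : Fin n → ℝ) : D.proj l k (D.retr l k u) = D.proj l k u :=
  D.proj_sect l k _

lemma retr_retr (l k : ℕ) (u : Fin n → ℝ) : D.retr l k (D.retr l k u) = D.retr l k u := by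
  rw [retr, proj_retr, ← retr]

lemma equiv_retr (l k : ℕ) (u : Fin n → ℝ) (c : Fin D.count) :
    D.equiv (D.retr l k u) c =
      algebraMap 𝕜 _ (if l ≤ D.size c + k then LocAlg.coeff 0 (D.equiv u c) else 0) := by
  rw [retr, sect, LinearEquiv.apply_symm_apply]
  split_ifs with h
  · rfl
  · rw [map_zero]

lemma isOpen_image_proj (l k : ℕ) {U : Set (Fin n → ℝ)} (hU : IsOpen U) :
    IsOpen (D.proj l k '' U) :=
  LinearMap.isOpenMap_of_finiteDimensional (D.projL l k).toLinearMap
    (fun z => ⟨D.sect l k z, D.proj_sect l k z⟩) U hU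

lemma proj_mem_closure (l k : ℕ) {U : Set (Fin n → ℝ)} {u : Fin n → ℝ} (hu : u ∈ closure U) :
    D.proj l k u ∈ closure (D.proj l k '' U) :=
  image_closure_subset_closure_image (D.projL l k).continuous ⟨u, hu, rfl⟩

/-- The component `u_c` of `u`, as an element of `A`. -/
def comp (l : ℕ) (c : Fin D.count) : (Fin n → ℝ) →L[ℝ] LocAlg lam l :=
  LinearMap.toContinuousLinearMap (((LocAlg.hat lam (D.size c) l).restrictScalars ℝ).comp
      ((LinearMap.proj c).comp D.equiv.toLinearMap))

lemma comp_apply (l : ℕ) (c : Fin D.count) (u : Fin n → ℝ) :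
    D.comp l c u = LocAlg.hat lam (D.size c) l (D.equiv u c) := rfl

/-- The inclusion of `𝕜` in `A`, as a continuous real linear map. -/
def inclL (lam : 𝕜) (l : ℕ) : 𝕜 →L[ℝ] LocAlg lam l :=
  LinearMap.toContinuousLinearMap ((Algebra.linearMap 𝕜 (LocAlg lam l)).restrictScalars ℝ)

@[simp] lemma inclL_apply (l : ℕ) (z : 𝕜) : inclL lam l z = algebraMap 𝕜 _ z := rfl

/-- The constant part of `comp`. -/
def coord (l k : ℕ) (c : D.Idx l k) : (Fin n → ℝ) →L[ℝ] LocAlg lam l :=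
  (inclL lam l).comp ((ContinuousLinearMap.proj c).comp (D.projL l k))

lemma coord_apply (l k : ℕ) (c : D.Idx l k) (u : Fin n → ℝ) :
    D.coord l k c u = algebraMap 𝕜 _ (D.proj l k u c) := rfl

/-- The nilpotent part of `comp`. -/
def eps (l k : ℕ) (c : D.Idx l k) : (Fin n → ℝ) →L[ℝ] LocAlg lam l :=
  D.comp l c.1 - D.coord l k c

lemma eps_apply (l k : ℕ) (c : D.Idx l k) (u : Fin n → ℝ) :
    D.eps l k c u = D.comp l c.1 (u - D.retr l k u) := by
  rw [map_sub, eps, sub_apply, coord_apply]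
  congr 1
  rw [comp_apply, equiv_retr, if_pos c.2, LocAlg.hat_algebraMap (D.size_pos _)]
  rfl

lemma e_dvd_eps (l k : ℕ) (c : D.Idx l k) (u : Fin n → ℝ) :
    LocAlg.e lam l ∣ D.eps l k c u := by
  rw [eps_apply, comp_apply]
  refine LocAlg.hat_eq_e_mul l _ ?_
  have h := congrFun (D.proj_retr l k u) c
  simp only [proj] at h
  rw [map_sub, Pi.sub_apply, ← LocAlg.coeffₗ_apply, map_sub, LocAlg.coeffₗ_apply,
    LocAlg.coeffₗ_apply, h, sub_self]

lemma eps_retr (l k i : ℕ) (c : D.Idx l k) (u : Fin n → ℝ) :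
    D.eps l k c (D.retr l i u) = 0 := by
  rw [eps_apply, map_sub, comp_apply, comp_apply, equiv_retr, equiv_retr, if_pos c.2, equiv_retr,
    LocAlg.coeff_zero_algebraMap (D.size_pos _), sub_self]

lemma retr_eq_self_of_mem_closure (l k : ℕ) {U : Set (Fin n → ℝ)} {b : Fin n → ℝ}
    (hb : b ∈ closure (D.retr l k '' U)) : D.retr l k b = b := by
  let R : (Fin n → ℝ) →ₗ[ℝ] (Fin n → ℝ) :=
    { toFun := D.retr l k
      map_add' := fun x y => D.equiv.injective (funext fun c => by
        rw [map_add, Pi.add_apply, equiv_retr, equiv_retr, equiv_retr, ← map_add, map_add D.equiv,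
          Pi.add_apply, ← LocAlg.coeffₗ_apply, map_add]
        split_ifs <;> simp)
      map_smul' := fun a x => D.equiv.injective (funext fun c => by
        rw [map_smul, Pi.smul_apply, equiv_retr, equiv_retr, map_smul, Pi.smul_apply,
          ← LocAlg.coeffₗ_apply, LinearMap.map_smul_of_tower, RingHom.id_apply]
        split_ifs
        · exact LinearMap.map_smul_of_tower (Algebra.linearMap 𝕜 (LocAlg lam (D.size c))) a _
        · rw [map_zero, smul_zero]) }
  have hR : Continuous (D.retr l k) := R.continuous_of_finiteDimensional
  have hcl : IsClosed {b | D.retr l k b = b} := isClosed_eq hR continuous_id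
  refine closure_minimal ?_ hcl hb
  rintro _ ⟨u, -, rfl⟩
  exact D.retr_retr l k u

lemma proj_gen (l k : ℕ) (c : D.Idx l k) : D.proj l k (D.gen c.1) = Pi.single c 1 := by
  funext d
  rw [proj, gen, LinearEquiv.apply_symm_apply]
  rcases eq_or_ne d c with rfl | h
  · rw [Pi.single_eq_same, Pi.single_eq_same, ← map_one (algebraMap 𝕜 _),
      LocAlg.coeff_zero_algebraMap (D.size_pos _)]
  · rw [Pi.single_eq_of_ne h, Pi.single_eq_of_ne fun h' => h (Subtype.ext h'),
      ← LocAlg.coeffₗ_apply, map_zero]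

lemma proj_gen_of_not (l k : ℕ) {c : Fin D.count} (hc : ¬ l ≤ D.size c + k) :
    D.proj l k (D.gen c) = 0 := by
  funext d
  rw [proj, gen, LinearEquiv.apply_symm_apply, Pi.single_eq_of_ne fun h' : d.1 = c => hc (h' ▸ d.2),
      ← LocAlg.coeffₗ_apply, map_zero]
  rfl

lemma comp_mulVec_mul_e_pow {l k : ℕ} (c : D.Idx l k) (x : Fin n → ℝ) :
    D.comp l c.1 (M.transpose.mulVec x) * LocAlg.e lam l ^ k =
      AdjoinRoot.root _ * D.comp l c.1 x * LocAlg.e lam l ^ k := by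
  rw [comp_apply, D.equiv_mulVec, ← AdjoinRoot.mk_X, LocAlg.hat_mk_mul_mul c.2, AdjoinRoot.mk_X]
  rfl

lemma comp_nil_pow_mul_e_pow {l k : ℕ} (c : D.Idx l k) (m : ℕ) (x : Fin n → ℝ) :
    D.comp l c.1 ((D.nil ^ m) x) * LocAlg.e lam l ^ k =
      D.comp l c.1 x * LocAlg.e lam l ^ (m + k) := by
  rw [comp_apply, equiv_nil_pow, LocAlg.e, ← map_pow, LocAlg.hat_mk_mul_mul c.2, map_pow,
    ← LocAlg.e, comp_apply]
  ring

variable {l k t : ℕ} {U : Set (Fin n → ℝ)}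

/-- The iterated partial derivatives of `f ∘ proj`, extended to the closure of `U`. -/
def jet (l k : ℕ) (U : Set (Fin n → ℝ)) (f : (D.Idx l k → 𝕜) → 𝕜) (p : List (D.Idx l k))
    (u : Fin n → ℝ) : LocAlg lam l :=
  algebraMap 𝕜 _ (extendFrom (D.proj l k '' U) (dirDeriv f p) (D.proj l k u))

variable {K : ℕ} {f : (D.Idx l k → 𝕜) → 𝕜}

/-- This holds at every u, even off the closure, since `extendFrom` depends only on values in the
open set. -/
lemma jet_perm (hU : IsOpen U) (hf : CkClosure 𝕜 K (D.proj l k '' U) f) (p q : List (D.Idx l k))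
    (hpq : p.Perm q) (h : p.length ≤ K) : D.jet l k U f p = D.jet l k U f q := by
  funext u
  rw [jet, jet, extendFrom_congr
    (dirDeriv_perm (D.isOpen_image_proj l k hU) hf.contDiffOn hpq h)]

lemma continuousOn_jet (hU : IsOpen U) (hf : CkClosure 𝕜 K (D.proj l k '' U) f)
    (p : List (D.Idx l k)) (h : p.length ≤ K) : ContinuousOn (D.jet l k U f p) (closure U) :=
  (inclL lam l).continuous.comp_continuousOn
    ((continuousOn_extendFrom_dirDeriv (D.isOpen_image_proj l k hU) hf p h).comp
      (D.projL l k).continuous.continuousOn fun _ hu => D.proj_mem_closure l k hu)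

lemma jet_of_mem (hU : IsOpen U) (hf : CkClosure 𝕜 K (D.proj l k '' U) f)
    (p : List (D.Idx l k)) (h : p.length ≤ K) {u : Fin n → ℝ} (hu : u ∈ U) :
    D.jet l k U f p u = algebraMap 𝕜 _ (dirDeriv f p (D.proj l k u)) := by
  rw [jet, extendFrom_extends ((contDiffOn_dirDeriv (D.isOpen_image_proj l k hU) hf.contDiffOn p 0
    (by omega)).continuousOn) _ ⟨u, hu, rfl⟩]

lemma hasFDerivAt_jet (hU : IsOpen U) (hf : CkClosure 𝕜 K (D.proj l k '' U) f)
    {u : Fin n → ℝ} (hu : u ∈ U) (p : List (D.Idx l k)) (h : p.length < K) :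
    HasFDerivAt (D.jet l k U f p)
      (∑ c, mulLeftL (D.coord l k c) (D.jet l k U f (c :: p) u)) u := by
  have h1 := (hasFDerivAt_dirDeriv (D.isOpen_image_proj l k hU) hf.contDiffOn p h
    (mem_image_of_mem _ hu)).restrictScalars ℝ
  have h2 := (inclL lam l).hasFDerivAt.comp u (h1.comp u (D.projL l k).hasFDerivAt)
  refine HasFDerivAt.congr_of_eventuallyEq (h2.congr_fderiv
    (ContinuousLinearMap.ext fun w => ?_)) ?_
  · simp only [sum_apply, mulLeftL_apply, ContinuousLinearMap.comp_apply, coord_apply,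
      ContinuousLinearMap.coe_restrictScalars', ContinuousLinearMap.smulRight_apply,
      ContinuousLinearMap.proj_apply, projL_apply, inclL_apply, map_sum, smul_eq_mul, map_mul]
    refine Finset.sum_congr rfl fun c _ => ?_
    rw [D.jet_of_mem hU hf (c :: p) h hu, mul_comm]
  · filter_upwards [hU.mem_nhds hu] with y hy
    exact D.jet_of_mem hU hf p h.le hy

/-- The contribution of `f_k` to `T f`, with `f_k` differentiated along the coordinates in `p`. -/
def term (l k : ℕ) (U : Set (Fin n → ℝ)) (f : (D.Idx l k → 𝕜) → 𝕜) (p : List (D.Idx l k)) :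
    (Fin n → ℝ) → LocAlg lam l :=
  taylorSum (D.jet l k U f) (D.eps l k) (LocAlg.e lam l ^ k) (l - 1 - k) p

lemma e_pow_mul_e_pow_eq_zero (hk : k < l) :
    LocAlg.e lam l ^ k * LocAlg.e lam l ^ (l - 1 - k + 1) = 0 := by
  rw [← pow_add]
  exact pow_eq_zero_of_le (by omega) (LocAlg.e_pow_self l)

lemma ckClosure_term (hU : IsOpen U) (hk : k < l)
    (hf : CkClosure 𝕜 (t + (l - 1 - k)) (D.proj l k '' U) f) {m : ℕ} {p : List (D.Idx l k)}
    (h : m + p.length ≤ t) : CkClosure ℝ m U (D.term l k U f p) :=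
  CkClosure.taylorSum hU (D.jet_perm hU hf) (fun _ hu => D.hasFDerivAt_jet hU hf hu)
    (D.continuousOn_jet hU hf) (D.e_dvd_eps l k) (e_pow_mul_e_pow_eq_zero hk) h

lemma hasFDerivAt_term (hU : IsOpen U) (hk : k < l)
    (hf : CkClosure 𝕜 (t + (l - 1 - k)) (D.proj l k '' U) f) {p : List (D.Idx l k)}
    (h : p.length < t) {u : Fin n → ℝ} (hu : u ∈ U) :
    HasFDerivAt (D.term l k U f p)
      (∑ c : D.Idx l k, mulLeftL (D.comp l c.1) (D.term l k U f (c :: p) u)) u := by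
  have := hasFDerivAt_taylorSum (D.jet_perm hU hf) (D.hasFDerivAt_jet hU hf hu)
    (D.e_dvd_eps l k) (e_pow_mul_e_pow_eq_zero hk) (p := p) (by omega)
  -- Coordinate and increment recombine to the full component.
  simp only [eps, add_sub_cancel] at this
  exact this

lemma e_pow_dvd_term (p : List (D.Idx l k)) (u : Fin n → ℝ) :
    LocAlg.e lam l ^ k ∣ D.term l k U f p u := Dvd.intro _ rfl

/-- The slice index i need not be k: points of any slice have constant components, so every
increment vanishes. -/
lemma term_of_retr_eq (i : ℕ) (p : List (D.Idx l k)) {b : Fin n → ℝ} (hb : D.retr l i b = b) :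
    D.term l k U f p b = LocAlg.e lam l ^ k * D.jet l k U f p b :=
  taylorSum_of_eps_eq_zero (fun c => by rw [← hb]; exact D.eps_retr l k i c b) _ _

lemma jet_nil (hf : CkClosure 𝕜 K (D.proj l k '' U) f) {u : Fin n → ℝ} (hu : u ∈ closure U) :
    D.jet l k U f [] u = algebraMap 𝕜 _ (f (D.proj l k u)) := by
  rw [jet]
  congr 1
  exact extendFrom_eq_of_continuousOn hf.continuousOn (fun _ _ => rfl) (D.proj_mem_closure l k hu)

lemma lift_dataDeriv (hU : IsOpen U) (hf : CkClosure 𝕜 K (D.proj l k '' U) f) {j : ℕ}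
    (hj : j ≤ K) {u : Fin n → ℝ} (hu : u ∈ closure U) :
    D.lift l k j (fun b => D.dataDeriv l k j U f (D.proj l k u) (fun r => D.proj l k (b r)))
        (fun _ => u - D.retr l k u) =
      LocAlg.e lam l ^ k * taylorTerm (D.jet l k U f) (D.eps l k) j [] u := by
  rw [taylorTerm_eq_sum (D.jet_perm hU hf) (by simpa using hj), lift, Finset.mul_sum]
  symm
  refine Fintype.sum_of_injective (fun (i : Fin j → D.Idx l k) r => (i r).1) ?_ _ _ ?_ ?_
  · intro i i' h
    funext r
    exact Subtype.ext (congrFun h r)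
  · intro i hi
    have : ∃ r, ¬ l ≤ D.size (i r) + k := by
      by_contra! hc
      exact hi ⟨fun r => ⟨i r, hc r⟩, rfl⟩
    obtain ⟨r, hr⟩ := this
    -- A unit from outside D_k projects to zero, so only index tuples inside D_k survive.
    rw [ContinuousMultilinearMap.map_coord_zero _ r (D.proj_gen_of_not l k hr), map_zero, zero_mul,
      mul_zero]
  · intro i
    simp only [proj_gen, List.append_nil, dataDeriv]
    rw [extendFrom_iteratedFDeriv_apply (D.isOpen_image_proj l k hU) hf hj i
      (D.proj_mem_closure l k hu), jet]
    simp only [eps_apply]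
    rw [mul_left_comm, mul_comm (LocAlg.e lam l ^ k)]
    rfl

lemma T_eq_sum_term (hU : IsOpen U) {f : ∀ k : ℕ, (D.Idx l k → 𝕜) → 𝕜}
    (hf : ∀ i : ℕ, i < l → CkClosure 𝕜 (t + (l - 1 - i)) (D.proj l i '' U) (f i))
    {u : Fin n → ℝ} (hu : u ∈ closure U) :
    D.T l U f u = ∑ k ∈ Finset.range l, D.term l k U (f k) [] u := by
  refine Finset.sum_congr rfl fun k hk => ?_
  have hf := hf k (by simpa using hk)
  rw [term, taylorSum, Finset.range_eq_Ico, Finset.sum_eq_sum_Ico_succ_bot (by omega), mul_add]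
  congr 1
  · rw [taylorTerm, D.jet_nil hf hu, mul_comm]; simp
  · rw [Finset.mul_sum]
    refine Finset.sum_congr rfl fun j hj => ?_
    rw [D.lift_dataDeriv hU hf (by simp at hj; omega) hu, mul_smul_comm,
      ← algebraMap_smul 𝕜 (j.factorial : ℝ)⁻¹, map_inv₀, map_natCast]

end CyclicDecomposition

/-- Meant for κ = e^k and r the root: components respect multiplication by the root only after
multiplication by e^k, which divides the coefficient a. -/
lemma mul_mul_eq_mul_mul_of_dvd {R : Type*} [CommRing R] {κ a p p' q q' r : R} (h : κ ∣ a)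
    (hp : p' * κ = r * p * κ) (hq : q' * κ = r * q * κ) : a * p' * q = a * p * q' := by
  obtain ⟨a, rfl⟩ := h
  linear_combination a * q * hp - a * p * hq

lemma fderiv_sum_mul_apply {E A : Type*} [NormedAddCommGroup E] [NormedSpace ℝ E]
    [NormedCommRing A] [NormedAlgebra ℝ A] {s : Finset ℕ} {ι : ℕ → Type*} [∀ k, Fintype (ι k)]
    {H : ∀ k, ι k → E → A} {H' : ∀ k, ι k → ι k → A} {ℓ : ∀ k, ι k → E →L[ℝ] A} {u : E}
    (h : ∀ k ∈ s, ∀ c, HasFDerivAt (H k c) (∑ d, mulLeftL (ℓ k d) (H' k c d)) u)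
    (Φ : A →L[ℝ] ℝ) (x y : E) :
    fderiv ℝ (fun u => Φ (∑ k ∈ s, ∑ c, H k c u * ℓ k c y)) u x =
      Φ (∑ k ∈ s, ∑ c, ∑ d, H' k c d * ℓ k d x * ℓ k c y) := by
  have h1 := HasFDerivAt.fun_sum (u := s) fun k hk =>
    HasFDerivAt.fun_sum (u := (Finset.univ : Finset (ι k))) fun c _ =>
      (h k hk c).mul_const (ℓ k c y)
  have h2 := (Φ.hasFDerivAt.comp u h1).fderiv
  rw [Function.comp_def] at h2
  rw [h2]
  simp only [ContinuousLinearMap.comp_apply, sum_apply, smul_apply, mulLeftL_apply,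
    smul_eq_mul, Finset.mul_sum]
  refine congrArg Φ (Finset.sum_congr rfl fun k _ => Finset.sum_congr rfl fun c _ =>
    Finset.sum_congr rfl fun d _ => ?_)
  ring

/-! ### Existence: φ(Tf) solves the problem -/

namespace CyclicDecomposition

variable {𝕜 : Type*} [RCLike 𝕜] {n : ℕ} {M : Matrix (Fin n) (Fin n) ℝ} {lam : 𝕜}
  (D : CyclicDecomposition M lam)

variable {l t : ℕ} {U : Set (Fin n → ℝ)} {f : ∀ k : ℕ, (D.Idx l k → 𝕜) → 𝕜}

/-- `phi` as a continuous linear map. -/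
def phiL (lam : 𝕜) (l : ℕ) : LocAlg lam l →L[ℝ] ℝ := LinearMap.toContinuousLinearMap (phiₗ lam l)

@[simp] lemma phiL_apply (a : LocAlg lam l) : phiL lam l a = phi a := phiₗ_apply a

/-- The derivative of `phi ∘ T f`, extended to the closure of `U`. -/
def derivSol (l : ℕ) (U : Set (Fin n → ℝ)) (f : ∀ k : ℕ, (D.Idx l k → 𝕜) → 𝕜)
    (u : Fin n → ℝ) : (Fin n → ℝ) →L[ℝ] ℝ :=
  (phiL lam l).comp (∑ k ∈ Finset.range l, ∑ c : D.Idx l k,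
    mulLeftL (D.comp l c.1) (D.term l k U (f k) [c] u))

lemma derivSol_apply (u x : Fin n → ℝ) :
    D.derivSol l U f u x = phi (∑ k ∈ Finset.range l, ∑ c : D.Idx l k,
      D.term l k U (f k) [c] u * D.comp l c.1 x) := by
  rw [← phiL_apply]
  simp only [derivSol, ContinuousLinearMap.comp_apply, sum_apply, mulLeftL_apply]

section

variable (hU : IsOpen U)
  (hf : ∀ i : ℕ, i < l → CkClosure 𝕜 (t + (l - 1 - i)) (D.proj l i '' U) (f i))

include hU hf

lemma ckClosure_phi_T : CkClosure ℝ t U (fun u => phi (D.T l U f u)) := by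
  have h : CkClosure ℝ t U (fun u => phiL lam l (∑ k ∈ Finset.range l, D.term l k U (f k) [] u)) :=
    (CkClosure.sum hU _ fun k hk => D.ckClosure_term hU (by simpa using hk)
      (hf k (by simpa using hk)) (by simp)).clm_comp hU _
  refine h.congr hU fun u hu => ?_
  simp only [phiL_apply]
  rw [D.T_eq_sum_term hU hf hu]

lemma hasFDerivAt_phi_T (ht : 1 ≤ t) {u : Fin n → ℝ} (hu : u ∈ U) :
    HasFDerivAt (fun u => phi (D.T l U f u)) (D.derivSol l U f u) u := by
  have h1 := HasFDerivAt.fun_sum (u := Finset.range l) fun k hk => D.hasFDerivAt_term hU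
    (by simpa using hk) (hf k (by simpa using hk)) (p := []) (by simp; omega) hu
  refine ((phiL lam l).hasFDerivAt.comp u h1).congr_of_eventuallyEq ?_
  filter_upwards [hU.mem_nhds hu] with y hy
  rw [D.T_eq_sum_term hU hf (subset_closure hy), Function.comp_apply, phiL_apply]

lemma continuousOn_derivSol (ht : 1 ≤ t) : ContinuousOn (D.derivSol l U f) (closure U) := by
  have h : ContinuousOn (fun u => ∑ k ∈ Finset.range l, ∑ c : D.Idx l k,
      mulLeftL (D.comp l c.1) (D.term l k U (f k) [c] u)) (closure U) :=
    continuousOn_finsetSum _ fun k hk => continuousOn_finsetSum _ fun c _ =>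
      (ContinuousLinearMap.continuous _).comp_continuousOn
        (D.ckClosure_term (m := 0) hU (by simpa using hk) (hf k (by simpa using hk))
          (by simp; omega)).continuousOn
  exact (ContinuousLinearMap.compL ℝ _ _ _ (phiL lam l)).continuous.comp_continuousOn h

lemma extendFrom_fderiv_phi_T (ht : 1 ≤ t) {b : Fin n → ℝ} (hb : b ∈ closure U) :
    extendFrom U (fderiv ℝ fun u => phi (D.T l U f u)) b = D.derivSol l U f b :=
  extendFrom_eq_of_continuousOn (D.continuousOn_derivSol hU hf ht)
    (fun _ hu => (D.hasFDerivAt_phi_T hU hf ht hu).fderiv.symm) hb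

lemma iteratedFDeriv_two_phi_T (ht : 2 ≤ t) {u : Fin n → ℝ} (hu : u ∈ U) (x y : Fin n → ℝ) :
    iteratedFDeriv ℝ 2 (fun u => phi (D.T l U f u)) u ![x, y] =
      phi (∑ k ∈ Finset.range l, ∑ c : D.Idx l k, ∑ d : D.Idx l k,
        D.term l k U (f k) [d, c] u * D.comp l d.1 x * D.comp l c.1 y) := by
  set v := fun u => phi (D.T l U f u) with hv
  rw [iteratedFDeriv_two_apply]
  simp only [Matrix.cons_val_zero, Matrix.cons_val_one]
  have hdiff : DifferentiableAt ℝ (fderiv ℝ v) u :=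
    (((D.ckClosure_phi_T hU hf).contDiffOn.contDiffAt (hU.mem_nhds hu)).fderiv_right (m := 1)
      (by exact_mod_cast ht)).differentiableAt one_ne_zero
  have h1 : fderiv ℝ (fderiv ℝ v) u x y = fderiv ℝ (fun u => fderiv ℝ v u y) u x := by
    rw [fderiv_clm_apply hdiff (differentiableAt_const _)]
    simp
  have h2 : (fun u => fderiv ℝ v u y) =ᶠ[𝓝 u] fun u => phiL lam l
      (∑ k ∈ Finset.range l, ∑ c : D.Idx l k, D.term l k U (f k) [c] u * D.comp l c.1 y) := by
    filter_upwards [hU.mem_nhds hu] with z hz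
    rw [(D.hasFDerivAt_phi_T hU hf (by omega) hz).fderiv, derivSol_apply, phiL_apply]
  rw [h1, h2.fderiv_eq, ← phiL_apply]
  exact fderiv_sum_mul_apply (fun k hk c => D.hasFDerivAt_term hU (by simpa using hk)
    (hf k (by simpa using hk)) (p := [c]) (by simp; omega) hu) (phiL lam l) x y

lemma laplace_phi_T (ht : 2 ≤ t) {u : Fin n → ℝ} (hu : u ∈ U) (x y : Fin n → ℝ) :
    iteratedFDeriv ℝ 2 (fun u => phi (D.T l U f u)) u ![M.transpose.mulVec x, y] =
      iteratedFDeriv ℝ 2 (fun u => phi (D.T l U f u)) u ![x, M.transpose.mulVec y] := by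
  rw [D.iteratedFDeriv_two_phi_T hU hf ht hu, D.iteratedFDeriv_two_phi_T hU hf ht hu]
  refine congrArg phi (Finset.sum_congr rfl fun k _ => Finset.sum_congr rfl fun c _ =>
    Finset.sum_congr rfl fun d _ => ?_)
  exact mul_mul_eq_mul_mul_of_dvd (D.e_pow_dvd_term [d, c] u) (D.comp_mulVec_mul_e_pow d x)
    (D.comp_mulVec_mul_e_pow c y)

lemma boundary_value_phi_T (hl : 0 < l) {b : Fin n → ℝ} (hb : b ∈ closure U)
    (hbr : D.retr l (l - 1) b = b) :
    phi (D.T l U f b) = mu (f (l - 1) (D.proj l (l - 1) b)) := by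
  rw [D.T_eq_sum_term hU hf hb, phi, ← LocAlg.coeffₗ_apply, map_sum,
    Finset.sum_eq_single_of_mem (l - 1) (by simpa using hl)]
  · rw [D.term_of_retr_eq (l - 1) _ hbr, D.jet_nil (hf _ (by omega)) hb, LocAlg.coeffₗ_apply,
      mul_comm, LocAlg.coeff_algebraMap_mul_e_pow (by omega), if_pos rfl]
  · intro k hk hkl
    rw [D.term_of_retr_eq (l - 1) _ hbr, D.jet_nil (hf _ (by simpa using hk)) hb,
      LocAlg.coeffₗ_apply, mul_comm, LocAlg.coeff_algebraMap_mul_e_pow (by omega), if_neg hkl.symm]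

lemma extendFrom_fderiv_data (ht : 1 ≤ t) {i : ℕ} (hi : i < l) {b : Fin n → ℝ}
    (hb : b ∈ closure U) (x : Fin n → ℝ) :
    extendFrom U (fderiv ℝ fun u => f i (D.proj l i u)) b x =
      ∑ c : D.Idx l i, D.proj l i x c *
        extendFrom (D.proj l i '' U) (dirDeriv (f i) [c]) (D.proj l i b) := by
  have hV := D.isOpen_image_proj l i hU
  have hfi := hf i hi
  let g : (Fin n → ℝ) → (Fin n → ℝ) →L[ℝ] 𝕜 := fun u => ∑ c : D.Idx l i,
    mulLeftL ((ContinuousLinearMap.proj c).comp (D.projL l i))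
      (extendFrom (D.proj l i '' U) (dirDeriv (f i) [c]) (D.proj l i u))
  have hg : ContinuousOn g (closure U) :=
    continuousOn_finsetSum _ fun c _ => (ContinuousLinearMap.continuous _).comp_continuousOn
      ((continuousOn_extendFrom_dirDeriv hV hfi [c] (by simp; omega)).comp
        (D.projL l i).continuous.continuousOn fun _ hu => D.proj_mem_closure l i hu)
  have hgU : EqOn g (fderiv ℝ fun u => f i (D.proj l i u)) U := by
    intro u hu
    have h1 := (hasFDerivAt_dirDeriv hV hfi.contDiffOn [] (by simp; omega)
      (mem_image_of_mem _ hu)).restrictScalars ℝ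
    have h2 := h1.comp u (D.projL l i).hasFDerivAt
    refine (Eq.trans ?_ h2.fderiv.symm : _)
    refine ContinuousLinearMap.ext fun w => ?_
    simp only [g, sum_apply, mulLeftL_apply, ContinuousLinearMap.comp_apply,
      ContinuousLinearMap.coe_restrictScalars', ContinuousLinearMap.smulRight_apply,
      ContinuousLinearMap.proj_apply, projL_apply, smul_eq_mul]
    refine Finset.sum_congr rfl fun c _ => ?_
    rw [extendFrom_extends ((contDiffOn_dirDeriv hV hfi.contDiffOn [c] 0
      (by simp; omega)).continuousOn) _ ⟨u, hu, rfl⟩, mul_comm]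
  rw [extendFrom_eq_of_continuousOn hg hgU hb]
  simp only [g, sum_apply, mulLeftL_apply, ContinuousLinearMap.comp_apply,
    ContinuousLinearMap.proj_apply, projL_apply]
  exact Finset.sum_congr rfl fun c _ => mul_comm _ _

lemma boundary_deriv_phi_T (ht : 1 ≤ t) {i : ℕ} (hi : i + 1 < l) {b x : Fin n → ℝ}
    (hb : b ∈ closure U) (hbr : D.retr l i b = b) (hx : D.retr l i x = x) :
    D.derivSol l U f b ((D.nil ^ (l - 1 - i)) x) =
      mu (extendFrom U (fderiv ℝ fun u => f i (D.proj l i u)) b x) := by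
  have key : ∀ k < l, ∀ c : D.Idx l k,
      D.term l k U (f k) [c] b * D.comp l c.1 ((D.nil ^ (l - 1 - i)) x) =
        algebraMap 𝕜 (LocAlg lam l) (LocAlg.coeff 0 (D.equiv x c.1) *
          extendFrom (D.proj l k '' U) (dirDeriv (f k) [c]) (D.proj l k b)) *
            LocAlg.e lam l ^ (l - 1 - i + k) := by
    intro k hk c
    have h1 : D.comp l c.1 x = algebraMap 𝕜 _ (LocAlg.coeff 0 (D.equiv x c.1)) := by
      have : D.equiv x c.1 = algebraMap 𝕜 _ (LocAlg.coeff 0 (D.equiv x c.1)) := by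
        conv_lhs => rw [← hx]
        conv_rhs => rw [← hx]
        rw [equiv_retr, LocAlg.coeff_zero_algebraMap (D.size_pos _)]
      rw [comp_apply, this, LocAlg.hat_algebraMap (D.size_pos _),
        LocAlg.coeff_zero_algebraMap (D.size_pos _)]
    rw [D.term_of_retr_eq i _ hbr, jet, map_mul, ← h1]
    linear_combination algebraMap 𝕜 (LocAlg lam l) (extendFrom (D.proj l k '' U)
      (dirDeriv (f k) [c]) (D.proj l k b)) * D.comp_nil_pow_mul_e_pow c (l - 1 - i) x
  -- The k-th part is a scalar times e^(l-1-i+k), and φ sees only the power l-1, that is k = i.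
  rw [derivSol_apply, Finset.sum_congr rfl fun k hk => Finset.sum_congr rfl fun c _ =>
    key k (by simpa using hk) c, phi, ← LocAlg.coeffₗ_apply, map_sum,
    Finset.sum_eq_single_of_mem i (by simp; omega), map_sum,
    D.extendFrom_fderiv_data hU hf ht (by omega) hb]
  · congr 1
    refine Finset.sum_congr rfl fun c _ => ?_
    rw [LocAlg.coeffₗ_apply, LocAlg.coeff_algebraMap_mul_e_pow (by omega), if_pos (by omega)]
    rfl
  · intro k hk hki
    rw [map_sum]
    refine Finset.sum_eq_zero fun c _ => ?_
    rw [LocAlg.coeffₗ_apply, LocAlg.coeff_algebraMap_mul_e_pow (by omega), if_neg (by omega)]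

end

lemma isSolution_phi_T (hU : IsOpen U) (hl : 0 < l)
    (hslice : ∀ i : ℕ, i < l → closure (D.retr l i '' U) ⊆ closure U) (ht : 2 ≤ t)
    (hf : ∀ i : ℕ, i < l → CkClosure 𝕜 (t + (l - 1 - i)) (D.proj l i '' U) (f i)) :
    D.IsSolution l t U f (fun u => phi (D.T l U f u)) where
  regular := D.ckClosure_phi_T hU hf
  laplace _ hb x y := D.laplace_phi_T hU hf ht hb x y
  boundary_value _ hb := D.boundary_value_phi_T hU hf hl (hslice _ (by omega) hb)
    (D.retr_eq_self_of_mem_closure l _ hb)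
  boundary_deriv i hi b hb x hx := by
    have hbU := hslice i (by omega) hb
    obtain ⟨x, rfl⟩ := hx
    rw [D.extendFrom_fderiv_phi_T hU hf (by omega) hbU]
    exact D.boundary_deriv_phi_T hU hf (by omega) hi hbU (D.retr_eq_self_of_mem_closure l i hb)
      (D.retr_retr l i x)

/-! ### Uniqueness -/

/-- A function that satisfies the homogeneous equations vanishes. -/
lemma eq_zero_of_homogeneous (hre : (RCLike.I : 𝕜) ≠ 0 → RCLike.im lam ≠ 0)
    (hsize : ∀ i, D.size i ≤ l) (hl : 0 < l) (hconv : Convex ℝ U) (hU : IsOpen U)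
    (hslice : ∀ i : ℕ, i < l → closure (D.retr l i '' U) ⊆ closure U)
    {w : (Fin n → ℝ) → ℝ} {w' : (Fin n → ℝ) → (Fin n → ℝ) →L[ℝ] ℝ}
    (hw : ContinuousOn w (closure U)) (hw2 : ContDiffOn ℝ 2 w U)
    (hw' : ContinuousOn w' (closure U)) (hd : EqOn w' (fderiv ℝ w) U)
    (hlap : ∀ b ∈ U, ∀ x y : Fin n → ℝ, iteratedFDeriv ℝ 2 w b ![M.transpose.mulVec x, y] =
      iteratedFDeriv ℝ 2 w b ![x, M.transpose.mulVec y])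
    (hval : ∀ b ∈ closure (D.retr l (l - 1) '' U), w b = 0)
    (hder : ∀ i : ℕ, i + 1 < l → ∀ b ∈ closure (D.retr l i '' U), ∀ x ∈ range (D.retr l i),
      w' b ((D.nil ^ (l - 1 - i)) x) = 0) :
    ∀ u ∈ closure U, w u = 0 := by
  have hretr : ∀ i < l, ∀ u ∈ U, D.retr l i u ∈ closure U := fun i hi u hu =>
    hslice i hi (subset_closure ⟨u, hu, rfl⟩)
  have hdw : ∀ u ∈ U, HasFDerivAt w (w' u) u := fun u hu => by
    rw [hd hu]
    exact ((hw2.contDiffAt (hU.mem_nhds hu)).differentiableAt two_ne_zero).hasFDerivAt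
  have hddw : ∀ u ∈ U, HasFDerivAt w' (fderiv ℝ (fderiv ℝ w) u) u := fun u hu => by
    refine HasFDerivAt.congr_of_eventuallyEq ?_ (hd.eventuallyEq_of_mem (hU.mem_nhds hu))
    exact (((hw2.contDiffAt (hU.mem_nhds hu)).fderiv_right (m := 1)
      (by norm_num)).differentiableAt one_ne_zero).hasFDerivAt
  -- Self-adjointness for D²w passes to all real polynomials in the operator, hence to `nil`.
  have hsymT : ∀ r : ℝ[X], ∀ u ∈ U, ∀ x y, fderiv ℝ (fderiv ℝ w) u
      (aeval (Matrix.toLin' M.transpose) r x) y =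
        fderiv ℝ (fderiv ℝ w) u x (aeval (Matrix.toLin' M.transpose) r y) := by
    intro r u hu
    induction r using Polynomial.induction_on with
    | C a => intro x y; simp [aeval_C]
    | add p q hp hq => intro x y; simp [hp, hq]
    | monomial m a h =>
      intro x y
      have hM : ∀ x y, fderiv ℝ (fderiv ℝ w) u (M.transpose.mulVec x) y =
          fderiv ℝ (fderiv ℝ w) u x (M.transpose.mulVec y) := fun x y => by
        simpa [iteratedFDeriv_two_apply] using hlap u hu x y
      have hcomm : aeval (Matrix.toLin' M.transpose) (C a * X ^ (m + 1)) =
          aeval (Matrix.toLin' M.transpose) (C a * X ^ m) * Matrix.toLin' M.transpose := by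
        rw [pow_succ, ← mul_assoc, map_mul, aeval_X]
      have hcomm' : aeval (Matrix.toLin' M.transpose) (C a * X ^ (m + 1)) =
          Matrix.toLin' M.transpose * aeval (Matrix.toLin' M.transpose) (C a * X ^ m) := by
        rw [pow_succ', mul_left_comm, map_mul, aeval_X]
      conv_lhs => rw [hcomm, Module.End.mul_apply, h, Matrix.toLin'_apply, hM]
      rw [hcomm', Module.End.mul_apply, Matrix.toLin'_apply]
  obtain ⟨r, hr⟩ := D.exists_aeval_eq_nil hre
  have hsym : ∀ m : ℕ, ∀ u ∈ U, ∀ x y, fderiv ℝ (fderiv ℝ w) u ((D.nil ^ m) x) y =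
        fderiv ℝ (fderiv ℝ w) u x ((D.nil ^ m) y) := by
    intro m u hu x y
    rw [← hr, ← map_pow]
    exact hsymT _ u hu x y
  have hstep : ∀ i < l, ∀ u ∈ closure U, ∀ x, w' u ((D.nil ^ (l - i)) x) = 0 := by
    intro i
    induction i with
    | zero =>
      intro _ u _ x
      rw [Nat.sub_zero, D.nil_pow_eq_zero hsize, map_zero]
    | succ i ih =>
      intro hi
      have ih := ih (by omega)
      have hexp : l - (i + 1) = l - 1 - i := by omega
      rw [hexp]
      have hUzero : ∀ u ∈ U, ∀ x, w' u ((D.nil ^ (l - 1 - i)) x) = 0 := by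
        intro u hu x
        have hb := hretr i (by omega) u hu
        have hcont : ContinuousOn (fun u => w' u ((D.nil ^ (l - 1 - i)) x)) (closure U) :=
          hw'.clm_apply continuousOn_const
        have hdiff : ∀ u ∈ U, HasFDerivAt (fun u => w' u ((D.nil ^ (l - 1 - i)) x))
            ((fderiv ℝ (fderiv ℝ w) u).flip ((D.nil ^ (l - 1 - i)) x)) u := fun u hu => by
          refine ((hddw u hu).clm_apply (hasFDerivAt_const _ _)).congr_fderiv ?_
          ext z; simp
        have hconst := eq_of_hasFDerivAt_apply_eq_zero hconv hU hcont hdiff hu hb (by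
          intro z hz
          -- Move N^(l-1-i) onto u - ρπu, where it becomes N^(l-i) y, then move N^(l-i) back onto x.
          -- What remains is the derivative in direction y of a function that vanishes by induction.
          obtain ⟨y, hy⟩ := D.exists_nil_pow_eq l i (by omega) u
          rw [ContinuousLinearMap.flip_apply, ← neg_sub, map_neg, neg_apply, ← hsym _ z hz, hy,
            hsym _ z hz, neg_eq_zero]
          have hz0 : (fun u => w' u ((D.nil ^ (l - i)) x)) =ᶠ[𝓝 z] fun _ => 0 := by
            filter_upwards [hU.mem_nhds hz] with z' hz' using ih z' (subset_closure hz') x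
          have h1 : HasFDerivAt (fun u => w' u ((D.nil ^ (l - i)) x))
              ((fderiv ℝ (fderiv ℝ w) z).flip ((D.nil ^ (l - i)) x)) z := by
            refine ((hddw z hz).clm_apply (hasFDerivAt_const _ _)).congr_fderiv ?_
            ext z; simp
          have h2 := h1.unique ((hasFDerivAt_const (0 : ℝ) z).congr_of_eventuallyEq hz0)
          have h3 := DFunLike.congr_fun h2 y
          simpa using h3)
        rw [hconst]
        -- The same splitting of x: the boundary condition handles ρπx, the induction hypothesis the
        -- rest.
        obtain ⟨x', hx'⟩ := D.exists_nil_pow_eq l i (by omega) x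
        rw [map_sub, sub_eq_iff_eq_add] at hx'
        rw [hx', map_add, ih _ hb, zero_add]
        exact hder i (by omega) _ (subset_closure ⟨u, hu, rfl⟩) _ ⟨x, rfl⟩
      intro u hu x
      have hcont : ContinuousOn (fun u => w' u ((D.nil ^ (l - 1 - i)) x)) (closure U) :=
        hw'.clm_apply continuousOn_const
      exact EqOn.of_subset_closure (fun u hu => hUzero u hu x) hcont continuousOn_const
        subset_closure subset_rfl hu
  have hUzero : ∀ u ∈ U, w u = 0 := by
    intro u hu
    have hb := hretr (l - 1) (by omega) u hu
    rw [eq_of_hasFDerivAt_apply_eq_zero hconv hU hw hdw hu hb fun z hz => ?_]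
    · exact hval _ (subset_closure ⟨u, hu, rfl⟩)
    -- For the last slice u - ρπu itself lies in the image of N, which Dw kills.
    · obtain ⟨y, hy⟩ := D.exists_nil_pow_eq l (l - 1) (by omega) u
      rw [Nat.sub_self, pow_zero, Module.End.one_apply] at hy
      rw [← neg_sub, map_neg, hy, hstep (l - 1) (by omega) z (subset_closure hz), neg_zero]
  exact fun u hu => EqOn.of_subset_closure hUzero hw continuousOn_const subset_closure subset_rfl hu

lemma IsSolution.eqOn {D : CyclicDecomposition M lam}
    (hre : (RCLike.I : 𝕜) ≠ 0 → RCLike.im lam ≠ 0)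
    (hsize : ∀ i, D.size i ≤ l) (hl : 0 < l) (hconv : Convex ℝ U) (hU : IsOpen U)
    (hslice : ∀ i : ℕ, i < l → closure (D.retr l i '' U) ⊆ closure U) (ht : 2 ≤ t)
    {f : ∀ k : ℕ, (D.Idx l k → 𝕜) → 𝕜} {v₁ v₂ : (Fin n → ℝ) → ℝ}
    (h₁ : D.IsSolution l t U f v₁) (h₂ : D.IsSolution l t U f v₂) : EqOn v₁ v₂ (closure U) := by
  obtain ⟨d₁, hd₁, e₁⟩ := h₁.regular.exists_fderiv (by omega)
  obtain ⟨d₂, hd₂, e₂⟩ := h₂.regular.exists_fderiv (by omega)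
  have ht' : (2 : WithTop ℕ∞) ≤ t := by exact_mod_cast ht
  have c₁ : ∀ u ∈ U, ContDiffAt ℝ 2 v₁ u := fun u hu =>
    (h₁.regular.contDiffOn.contDiffAt (hU.mem_nhds hu)).of_le ht'
  have c₂ : ∀ u ∈ U, ContDiffAt ℝ 2 v₂ u := fun u hu =>
    (h₂.regular.contDiffOn.contDiffAt (hU.mem_nhds hu)).of_le ht'
  have key := D.eq_zero_of_homogeneous hre hsize hl hconv hU hslice (w := v₁ - v₂)
    (w' := fun u => d₁ u - d₂ u) (h₁.regular.continuousOn.sub h₂.regular.continuousOn)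
    (fun u hu => ((c₁ u hu).sub (c₂ u hu)).contDiffWithinAt) (hd₁.sub hd₂)
    (fun u hu => by
      rw [fderiv_sub ((c₁ u hu).differentiableAt two_ne_zero)
        ((c₂ u hu).differentiableAt two_ne_zero), ← e₁ hu, ← e₂ hu])
    (fun b hb x y => by
      rw [iteratedFDeriv_sub_apply (c₁ b hb) (c₂ b hb)]
      simp only [sub_apply, h₁.laplace b hb x y, h₂.laplace b hb x y])
    (fun b hb => by
      rw [Pi.sub_apply, h₁.boundary_value b hb, h₂.boundary_value b hb, sub_self])
    (fun i hi b hb x hx => by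
      have hbU := hslice i (by omega) hb
      rw [sub_apply, ← extendFrom_eq_of_continuousOn hd₁ e₁ hbU,
        ← extendFrom_eq_of_continuousOn hd₂ e₂ hbU, h₁.boundary_deriv i hi b hb x hx,
        h₂.boundary_deriv i hi b hb x hx, sub_self])
  exact fun u hu => sub_eq_zero.mp (key u hu)

end CyclicDecomposition

end GenLaplace

end

theorem theoremT {𝕜 : Type*} [RCLike 𝕜] {n : ℕ} (M : Matrix (Fin n) (Fin n) ℝ) (lam : 𝕜)
    (hM : GenLaplace.HasSingleEigenvalue M lam)
    (l : ℕ) (hl : l = GenLaplace.eigenIndex M lam)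
    (D : GenLaplace.CyclicDecomposition M lam)
    (U : Set (Fin n → ℝ)) (hUconv : Convex ℝ U) (hUopen : IsOpen U)
    (hUbdd : Bornology.IsBounded U)
    (hUslice : ∀ i : ℕ, i < l → closure (D.retr l i '' U) ⊆ closure U)
    (t : ℕ) (ht : 2 ≤ t)
    (f : ∀ k : ℕ, (D.Idx l k → 𝕜) → 𝕜)
    (hf : ∀ i : ℕ, i < l → GenLaplace.CkClosure 𝕜 (t + (l - 1 - i)) (D.proj l i '' U) (f i)) :
    D.IsSolution l t U f (fun u => GenLaplace.phi (D.T l U f u)) ∧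
      ∀ v : (Fin n → ℝ) → ℝ, D.IsSolution l t U f v →
        ∀ u ∈ closure U, v u = GenLaplace.phi (D.T l U f u) := by
  have hsize : ∀ i, D.size i ≤ l := fun i => hl ▸ D.size_le_eigenIndex i
  -- Having an eigenvalue excludes n = 0, so there is at least one summand.
  have hl0 : 0 < l := (D.size_pos ⟨0, D.count_pos hM.pos⟩).trans (hsize _)
  have hsol := D.isSolution_phi_T hUopen hl0 hUslice ht hf
  exact ⟨hsol, fun v hv => hv.eqOn hM.1 hsize hl0 hUconv hUopen hUslice ht hsol⟩
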